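/- (Hasse–Arf.) Let $K$ be a field with a discrete valuation $v_K$ (normalized: $v_K : K^\times \to \mathbb{Z}$ surjective) with respect to which $K$ is complete, let $A$ be its valuation ring, and let $L/K$ be a finite Galois extension with abelian group $G=\mathrm{Gal}(L/K)$. Let $v_L$ be the normalized discrete valuation of $L$ extending $v_K$ (that is, $v_L|_{K^\times}=e\,v_K$ for an integer $e>0$), let $B$ be the integral closure of $A$ in $L$, and assume that the extension of residue fields of $L/K$ is separable. For an integer $i\ge -1$ put $$G_i=\{\sigma\in G : v_L(\sigma(b)-b)\ge i+1 \text{ for all } b\in B\},$$ and for real $u\ge -1$ put $G_u=G_{\lceil u\rceil}$. Let $\varphi:[-1,\infty)\to[-1,\infty)$ be the bijection $$\varphi(u)=\int_0^u\frac{dt}{(G_0:G_t)},\qquad\text{where } (G_0:G_t):=(G_t:G_0)^{-1}\text{ for } -1\le t<0,$$ let $\psi$ be its inverse, and let $G^s=G_{\psi(s)}$ for real $s\ge -1$ (the upper numbering filtration). If $u\in[-1,\infty)$ is a jump of this filtration, i.e. $G^{u}\supsetneq G^{u+\varepsilon}$ for all $\varepsilon>0$, then $u$ is an integer. -/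

import Mathlib

namespace HasseArf

noncomputable section

variable {K L : Type*} [Field K] [Field L] [Algebra K L]

/-- A discrete valuation in multiplicative notation: the additive valuation `x ↦ -log (v x)` is a
surjection from the nonzero elements onto `ℤ`, and `v x ≤ exp (-n)` says that the additive
valuation of `x` is at least `n`. -/
def IsDiscreteValuation (v : Valuation K (WithZero (Multiplicative ℤ))) : Prop :=
  Function.Surjective v

/-- The ramification group `G_i` of `Gal(L/K)` in the lower numbering, for an integer `i ≥ -1`:
the automorphisms `σ` such that `σ b - b` has additive `w`-valuation at least `i + 1` for all `b`
in the integral closure in `L` of the valuation ring of `v`. -/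
def lowerGroup (v : Valuation K (WithZero (Multiplicative ℤ)))
    (w : Valuation L (WithZero (Multiplicative ℤ))) (i : ℤ) : Subgroup Gal(L/K) where
  carrier := {σ | ∀ b ∈ integralClosure v.valuationSubring L, w (σ b - b) ≤ WithZero.exp (-(i + 1))}
  mul_mem' := by
    intro σ τ hσ hτ b hb
    have hτb : τ b ∈ integralClosure v.valuationSubring L :=
      IsIntegral.map (τ.toAlgHom.restrictScalars v.valuationSubring) hb
    have h : (σ * τ) b - b = (σ (τ b) - τ b) + (τ b - b) := by
      rw [AlgEquiv.mul_apply]; ring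
    rw [h]
    exact w.map_add_le (hσ _ hτb) (hτ _ hb)
  one_mem' := by
    intro b _
    simp
  inv_mem' := by
    intro σ hσ b hb
    have hc : σ⁻¹ b ∈ integralClosure v.valuationSubring L :=
      IsIntegral.map ((σ⁻¹).toAlgHom.restrictScalars v.valuationSubring) hb
    have h : σ⁻¹ b - b = -(σ (σ⁻¹ b) - σ⁻¹ b) := by
      rw [← AlgEquiv.mul_apply, mul_inv_cancel, AlgEquiv.one_apply]; ring
    rw [h, Valuation.map_neg]
    exact hσ _ hc

/-- The lower numbering extended to real indices: `G_u = G_⌈u⌉`. -/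
def lowerGroupReal (v : Valuation K (WithZero (Multiplicative ℤ)))
    (w : Valuation L (WithZero (Multiplicative ℤ))) (u : ℝ) : Subgroup Gal(L/K) :=
  lowerGroup v w ⌈u⌉

/-- The index `(G_0 : G_t)`, which by convention is `(G_t : G_0)⁻¹` for `t < 0`. -/
def lowerIndex (v : Valuation K (WithZero (Multiplicative ℤ)))
    (w : Valuation L (WithZero (Multiplicative ℤ))) (t : ℝ) : ℝ :=
  if 0 ≤ t then ((lowerGroupReal v w t).relIndex (lowerGroupReal v w 0) : ℝ)
  else ((lowerGroupReal v w 0).relIndex (lowerGroupReal v w t) : ℝ)⁻¹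

/-- The Herbrand function `φ_{L/K}(u) = ∫₀ᵘ dt / (G_0 : G_t)`. -/
def herbrandPhi (v : Valuation K (WithZero (Multiplicative ℤ)))
    (w : Valuation L (WithZero (Multiplicative ℤ))) (u : ℝ) : ℝ :=
  ∫ t in (0 : ℝ)..u, 1 / lowerIndex v w t

/-- The inverse `ψ_{L/K}` of the bijection `φ_{L/K} : [-1, ∞) → [-1, ∞)`. -/
def herbrandPsi (v : Valuation K (WithZero (Multiplicative ℤ)))
    (w : Valuation L (WithZero (Multiplicative ℤ))) : ℝ → ℝ :=
  Function.invFunOn (herbrandPhi v w) (Set.Ici (-1))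

/-- The ramification group `G^s = G_{ψ(s)}` in the upper numbering, for real `s ≥ -1`. -/
def upperGroup (v : Valuation K (WithZero (Multiplicative ℤ)))
    (w : Valuation L (WithZero (Multiplicative ℤ))) (s : ℝ) : Subgroup Gal(L/K) :=
  lowerGroupReal v w (herbrandPsi v w s)

/-- A jump of the upper numbering filtration: a real number `u ≥ -1` such that `G^(u+ε)` is a
proper subgroup of `G^u` for every `ε > 0`. -/
def IsUpperJump (v : Valuation K (WithZero (Multiplicative ℤ)))
    (w : Valuation L (WithZero (Multiplicative ℤ))) (u : ℝ) : Prop :=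
  -1 ≤ u ∧ ∀ ε : ℝ, 0 < ε → upperGroup v w (u + ε) < upperGroup v w u

end

end HasseArf

/-!
The upper numbering jumps of the abelian extension `L/K` are the values `φ(t)` of the Herbrand
function at the lower jumps `t` (`IsUpperJump.exists_lower_jump`), and for `t ≥ 1`
`φ(t) = (|G_1| + ⋯ + |G_t|) / |G_0|`. The numerator counts pairs, so it is the sum over `g ∈ G_0` of
the break `i(g) = v_L(g π / π - 1)` truncated at `t` (`sum_card_lowerGroup`), and the theorem says
that this sum is divisible by `|G_0|` (`TotRam.card_dvd_sum_truncBrk`).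

Completeness of `K` enters only through the invariance of the valuation of `L` under `Gal(L/K)`
(`valuation_algEquiv`), and separability of the residue extension only through the fact that every
residue class of `L` contains an element fixed by the inertia group (`exists_fixed_sub_lt_one`).
These two facts make the action of `G_0` on `L` totally ramified in the sense of `TotRam`, and the
rest of the argument takes place in that setting, with no base field.

The quotient `G_0/G_1` is cyclic of order prime to the residue characteristic `p`. Since `G_0` is
commutative, that order divides every break of `G_1` and every positive `t` that is a break
(`TotRam.card_tame_dvd`). It remains to treat the `p`-group `G_1`. Choose a subgroup `H`
of `G_1` with cyclic quotient that contains the elements of break greater than `t` and misses one of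
break `t`. The breaks on the fixed field of `H` are the means of the breaks over the cosets of `H`
(`TotRam.dep_fixed`), and with this the sum of truncated breaks of `G_1` becomes `|H|` times the
corresponding sum for a generator `σ` of the cyclic quotient, in which `t` has become the last jump.
For a cyclic group the required divisibility follows from Sen's congruences
`i(σ^(p^n)) ≡ i(σ^(p^(n-1))) mod p^n` (`TotRam.sen`, `pow_dvd_sum_breaks`).

Sen's theorem rests on the partial norms `X_M = π · σπ ⋯ σ^(M-1)π`: they have valuation `M` and
`σ X_M - X_M` has valuation `M + i(σ^M)`. Given the earlier congruences, these valuations are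
distinct for `M` not divisible by `p^n` and avoid one residue class modulo `p^n`. A failure of the
next congruence would produce an element `y` for which `σ y - y` lies in the avoided class while the
valuation of `y` is too large for the terms with `p^n ∣ M` of its expansion in the `X_M` to account
for it (`TotRam.not_large_of_w_smul_sub`).
-/

namespace HasseArf

open Finset
open scoped NNReal WithZero

/-! ### Totally ramified group actions on a discretely valued field -/

section

/-- The action of a group `G` on a discretely valued field `F` is totally ramified, with
uniformizer `π`: the value group is generated by `w π < 1`, the valuation is `G`-invariant, and
every integral element is congruent to a `G`-fixed element modulo the maximal ideal.

The codomain `Γ₀` of `w` may be larger than the group generated by `w π`; this makes the notion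
available for subfields without renormalizing the valuation. -/
structure TotRam {F Γ₀ : Type*} [Field F] [LinearOrderedCommGroupWithZero Γ₀] (w : Valuation F Γ₀)
    (G : Type*) [Group G] [MulSemiringAction G F] (π : F) : Prop where
  lt_one : w π < 1
  ne_zero : π ≠ 0
  exists_zpow : ∀ x : F, x ≠ 0 → ∃ k : ℤ, w x = w π ^ k
  invariant : ∀ (g : G) (x : F), w (g • x) = w x
  residue : ∀ x : F, w x ≤ 1 → ∃ c : F, (∀ g : G, g • c = c) ∧ w (x - c) < 1

variable {F Γ₀ G : Type*} [Field F] [LinearOrderedCommGroupWithZero Γ₀] {w : Valuation F Γ₀}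
  [Group G] [MulSemiringAction G F] {π : F}

/-- The depth `w (g π / π - 1)` of a group element, in multiplicative notation. -/
def dep (w : Valuation F Γ₀) (π : F) (g : G) : Γ₀ := w (g • π / π - 1)

open Classical in
/-- The break of a group element: the integer `i` such that `g π / π - 1` has valuation `i` times
that of `π`. The junk value `0` is used when `g π = π`. -/
noncomputable def brk (w : Valuation F Γ₀) (π : F) (g : G) : ℤ :=
  if h : ∃ k : ℤ, dep w π g = w π ^ k then h.choose else 0

namespace TotRam

variable (T : TotRam w G π)
include T

lemma pos : 0 < w π := zero_lt_iff.mpr ((Valuation.ne_zero_iff w).mpr T.ne_zero)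

lemma w_ne_zero : w π ≠ 0 := T.pos.ne'

lemma zpow_le_zpow_iff {a b : ℤ} : w π ^ a ≤ w π ^ b ↔ b ≤ a :=
  zpow_le_zpow_iff_right_of_lt_one₀ T.pos T.lt_one

lemma zpow_lt_zpow_iff {a b : ℤ} : w π ^ a < w π ^ b ↔ b < a :=
  zpow_lt_zpow_iff_right_of_lt_one₀ T.pos T.lt_one

lemma zpow_inj {a b : ℤ} (h : w π ^ a = w π ^ b) : a = b :=
  le_antisymm (T.zpow_le_zpow_iff.mp h.ge) (T.zpow_le_zpow_iff.mp h.le)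

lemma le_zpow_succ {x : F} {k : ℤ} (h : w x < w π ^ k) : w x ≤ w π ^ (k + 1) := by
  by_cases hx : x = 0
  · simp [hx]
  · obtain ⟨m, hm⟩ := T.exists_zpow x hx
    rw [hm, T.zpow_lt_zpow_iff] at h
    rw [hm, T.zpow_le_zpow_iff]
    omega

lemma le_of_lt_one {x : F} (h : w x < 1) : w x ≤ w π := by
  simpa using T.le_zpow_succ (k := 0) (by simpa using h)

/-- An element smaller than all powers of the uniformizer vanishes. -/
lemma eq_zero_of_le_pow {x : F} {γ : Γ₀} {z : F} (hz : γ = w z)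
    (h : ∀ k : ℕ, w x ≤ γ * w π ^ k) : x = 0 := by
  by_contra hx
  obtain ⟨m, hm⟩ := T.exists_zpow x hx
  have hz0 : z ≠ 0 := by
    rintro rfl
    have := h 0
    rw [hz] at this
    simp [hx] at this
  obtain ⟨l, hl⟩ := T.exists_zpow z hz0
  have := h (m - l + 1).toNat
  rw [hz, hm, hl, ← zpow_natCast, ← zpow_add₀ T.w_ne_zero, T.zpow_le_zpow_iff] at this
  omega

/-- Expansion of `a` to `k` digits in powers of `π`, with fixed coefficients. -/
lemma smul_sub_le_aux (g : G) (k : ℕ) :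
    ∀ a : F, w a ≤ 1 → w (g • a - a) ≤ max (w (g • π - π)) (w π ^ k) := by
  induction k with
  | zero =>
    intro a ha
    rw [pow_zero]
    exact le_max_of_le_right ((w.map_sub _ _).trans (by rw [T.invariant, max_self]; exact ha))
  | succ k ih =>
    intro a ha
    obtain ⟨c, hc, hac⟩ := T.residue a ha
    set b := (a - c) / π with hb
    have hb1 : w b ≤ 1 := by
      rw [hb, map_div₀]
      exact div_le_one_of_le₀ (T.le_of_lt_one hac) zero_le
    have hab : a = c + π * b := by rw [hb, mul_div_cancel₀ _ T.ne_zero]; ring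
    have key : g • a - a = (g • π - π) * g • b + π * (g • b - b) := by
      rw [hab, smul_add, smul_mul', hc g]; ring
    rw [key]
    refine (w.map_add _ _).trans (max_le ?_ ?_)
    · rw [map_mul, T.invariant]
      exact le_max_of_le_left (mul_le_of_le_one_right' hb1)
    · rw [map_mul]
      rcases le_max_iff.mp (ih b hb1) with h | h
      · exact le_max_of_le_left ((mul_le_of_le_one_left' T.lt_one.le).trans h)
      · exact le_max_of_le_right (by rw [pow_succ']; exact mul_le_mul_right h _)

/-- An automorphism moves the uniformizer at least as far as any other integral element. -/
lemma smul_sub_le (g : G) {a : F} (ha : w a ≤ 1) : w (g • a - a) ≤ w (g • π - π) := by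
  by_cases h0 : g • π - π = 0
  · have : g • a - a = 0 := by
      refine T.eq_zero_of_le_pow (γ := 1) (z := 1) (by simp) fun k ↦ ?_
      simpa [h0] using T.smul_sub_le_aux g k a ha
    simp [this]
  · obtain ⟨m, hm⟩ := T.exists_zpow _ h0
    rcases le_max_iff.mp (T.smul_sub_le_aux g (m + 1).toNat a ha) with h | h
    · exact h
    · refine h.trans ?_
      rw [hm, ← zpow_natCast, T.zpow_le_zpow_iff]
      omega

lemma w_smul_sub (g : G) : w (g • π - π) = w π * dep w π g := by
  rw [dep, ← map_mul, mul_sub, mul_div_cancel₀ _ T.ne_zero, mul_one]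

lemma w_ratio (g : G) {x : F} (hx : x ≠ 0) : w (g • x / x) = 1 := by
  rw [map_div₀, T.invariant, div_self ((Valuation.ne_zero_iff w).mpr hx)]

lemma dep_le_one (g : G) : dep w π g ≤ 1 :=
  (w.map_sub _ _).trans (by rw [T.w_ratio g T.ne_zero, map_one, max_self])

lemma smul_sub_le_of_unit (g : G) {u : F} (hu : w u = 1) : w (g • u - u) ≤ w π * dep w π g := by
  rw [← T.w_smul_sub]
  exact T.smul_sub_le g hu.le

omit T in
lemma ne_zero_of_smul {x : F} (g : G) (hx : x ≠ 0) : g • x ≠ 0 := by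
  rwa [Ne, smul_eq_zero_iff_eq]

/-- Up to terms deeper than `g`, the cocycle `x ↦ g x / x` only depends on the valuation of `x`. -/
lemma ratio_sub_le (g : G) {x : F} {k : ℤ} (hx : w x = w π ^ k) :
    w (g • x / x - (g • π / π) ^ k) ≤ w π * dep w π g := by
  have hπk : π ^ k ≠ 0 := zpow_ne_zero _ T.ne_zero
  set u := x / π ^ k with hu
  have hu1 : w u = 1 := by
    rw [hu, map_div₀, map_zpow₀, hx, div_self (zpow_ne_zero _ T.w_ne_zero)]
  have hu0 : u ≠ 0 := by intro h; simp [h] at hu1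
  have hxu : x = u * π ^ k := by rw [hu, div_mul_cancel₀ _ hπk]
  have hgk : g • π ^ k = (g • π) ^ k := map_zpow₀ (MulSemiringAction.toRingHom G F g) π k
  have key : g • x / x - (g • π / π) ^ k = (g • u - u) * ((g • π / π) ^ k / u) := by
    rw [hxu, smul_mul', hgk, div_zpow]
    field_simp
  rw [key, map_mul, map_div₀, map_zpow₀, T.w_ratio g T.ne_zero, hu1]
  simpa using T.smul_sub_le_of_unit g hu1

omit T in
lemma w_pow_sub_one_le {y : F} (hy : w y = 1) (n : ℕ) : w (y ^ n - 1) ≤ w (y - 1) := by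
  rw [← mul_geom_sum, map_mul]
  refine mul_le_of_le_one_right' (w.map_sum_le fun i _ ↦ ?_)
  rw [map_pow, hy, one_pow]

omit T in
lemma w_inv_sub_one {y : F} (hy : w y = 1) : w (y⁻¹ - 1) = w (y - 1) := by
  have h0 : y ≠ 0 := by rintro rfl; simp at hy
  have : y⁻¹ - 1 = - ((y - 1) / y) := by field_simp; ring
  rw [this, Valuation.map_neg, map_div₀, hy, div_one]

omit T in
lemma w_zpow_sub_one_le {y : F} (hy : w y = 1) (n : ℤ) : w (y ^ n - 1) ≤ w (y - 1) := by
  obtain ⟨n, rfl | rfl⟩ := n.eq_nat_or_neg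
  · simpa using w_pow_sub_one_le hy n
  · rw [zpow_neg, zpow_natCast, w_inv_sub_one (by rw [map_pow, hy, one_pow])]
    exact w_pow_sub_one_le hy n

lemma ratio_sub_one_le (g : G) {x : F} (hx : x ≠ 0) : w (g • x / x - 1) ≤ dep w π g := by
  obtain ⟨k, hk⟩ := T.exists_zpow x hx
  have : g • x / x - 1 = (g • x / x - (g • π / π) ^ k) + ((g • π / π) ^ k - 1) := by ring
  rw [this]
  refine (w.map_add _ _).trans (max_le ((T.ratio_sub_le g hk).trans ?_) ?_)
  · exact mul_le_of_le_one_left' T.lt_one.le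
  · exact w_zpow_sub_one_le (T.w_ratio g T.ne_zero) k

lemma smul_sub_le_mul (g : G) (x : F) : w (g • x - x) ≤ w x * dep w π g := by
  by_cases hx : x = 0
  · simp [hx]
  · have : g • x - x = x * (g • x / x - 1) := by field_simp
    rw [this, map_mul]
    exact mul_le_mul_right (T.ratio_sub_one_le g hx) _

/-! ### Depth and break of group elements -/

lemma dep_mul_le (g h : G) : dep w π (g * h) ≤ max (dep w π g) (dep w π h) := by
  have h0 := ne_zero_of_smul h T.ne_zero
  have : (g * h) • π / π - 1 =
      (g • (h • π) / (h • π) - 1) * (h • π / π) + (h • π / π - 1) := by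
    rw [mul_smul]; field_simp [T.ne_zero]; ring
  rw [dep, this]
  refine (w.map_add _ _).trans (max_le_max ?_ le_rfl)
  rw [map_mul, T.w_ratio h T.ne_zero, mul_one]
  exact T.ratio_sub_one_le g h0

omit T in
lemma dep_one (hπ : π ≠ 0) : dep w π (1 : G) = 0 := by simp [dep, hπ]

lemma dep_inv (g : G) : dep w π g⁻¹ = dep w π g := by
  have key : ∀ g : G, dep w π g⁻¹ ≤ dep w π g := by
    intro g
    have h : w (g⁻¹ • π - π) = w (g • π - π) := by
      rw [← T.invariant g, smul_sub, smul_inv_smul, Valuation.map_sub_swap]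
    rw [T.w_smul_sub, T.w_smul_sub] at h
    exact (mul_left_cancel₀ T.w_ne_zero h).le
  exact le_antisymm (key g) (by simpa using key g⁻¹)

lemma dep_mul_eq_right {g h : G} (hlt : dep w π g < dep w π h) : dep w π (g * h) = dep w π h := by
  refine le_antisymm ((T.dep_mul_le g h).trans (max_le hlt.le le_rfl)) ?_
  have := T.dep_mul_le g⁻¹ (g * h)
  rw [inv_mul_cancel_left, T.dep_inv] at this
  rcases le_max_iff.mp this with h' | h'
  · exact absurd h' (not_le.mpr hlt)
  · exact h'

/-- The subgroup of elements of depth at most `γ`. -/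
def depLE (γ : Γ₀) : Subgroup G where
  carrier := {g | dep w π g ≤ γ}
  mul_mem' ha hb := (T.dep_mul_le _ _).trans (max_le ha hb)
  one_mem' := by simp [dep_one T.ne_zero]
  inv_mem' {x} hx := by simpa [T.dep_inv] using hx

/-- The subgroup of elements of depth less than `w π ^ t`. -/
def depLT (t : ℤ) : Subgroup G where
  carrier := {g | dep w π g < w π ^ t}
  mul_mem' ha hb := (T.dep_mul_le _ _).trans_lt (max_lt ha hb)
  one_mem' := by simpa [dep_one T.ne_zero] using zpow_pos T.pos t
  inv_mem' {x} hx := by simpa [T.dep_inv] using hx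

lemma mem_depLE {γ : Γ₀} {g : G} : g ∈ T.depLE γ ↔ dep w π g ≤ γ := Iff.rfl

lemma mem_depLT {t : ℤ} {g : G} : g ∈ T.depLT t ↔ dep w π g < w π ^ t := Iff.rfl

lemma dep_zpow_le (g : G) (n : ℤ) : dep w π (g ^ n) ≤ dep w π g :=
  (T.depLE (dep w π g)).zpow_mem (T.mem_depLE.mpr le_rfl) n

lemma dep_pow_le (g : G) (n : ℕ) : dep w π (g ^ n) ≤ dep w π g := by
  simpa using T.dep_zpow_le g n

lemma dep_eq_zero_iff {g : G} : dep w π g = 0 ↔ ∀ x : F, g • x = x := by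
  constructor
  · intro h x
    have := T.smul_sub_le_mul g x
    rw [h, mul_zero, le_zero_iff, Valuation.zero_iff, sub_eq_zero] at this
    exact this
  · intro h
    simp [dep, h, T.ne_zero]

lemma exists_dep_eq {g : G} (h : dep w π g ≠ 0) : ∃ k : ℤ, dep w π g = w π ^ k :=
  T.exists_zpow _ ((Valuation.ne_zero_iff w).mp h)

lemma dep_eq {g : G} (h : dep w π g ≠ 0) : dep w π g = w π ^ brk w π g := by
  have h' := T.exists_dep_eq h
  rw [brk, dif_pos h']
  exact h'.choose_spec

lemma brk_eq {g : G} {k : ℤ} (h : dep w π g = w π ^ k) : brk w π g = k := by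
  refine T.zpow_inj ?_
  rw [← T.dep_eq (by rw [h]; exact zpow_ne_zero _ T.w_ne_zero), h]

omit T in
lemma brk_congr {g h : G} (hgh : dep w π g = dep w π h) : brk w π g = brk w π h := by
  unfold brk
  generalize dep w π g = a at *
  subst hgh
  rfl

/-- Restricting a totally ramified action to a subgroup. -/
lemma restrict (H : Subgroup G) : TotRam w H π where
  lt_one := T.lt_one
  ne_zero := T.ne_zero
  exists_zpow := T.exists_zpow
  invariant g x := T.invariant (g : G) x
  residue x hx := by
    obtain ⟨c, hc, h⟩ := T.residue x hx
    exact ⟨c, fun g ↦ hc g, h⟩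

end TotRam

end

/-! ### Sen's congruence -/

section

variable {F Γ₀ G : Type*} [Field F] [LinearOrderedCommGroupWithZero Γ₀] {w : Valuation F Γ₀}
  [Group G] [MulSemiringAction G F] {π : F}

/-- In a sum whose nonzero terms have distinct valuations, the valuation is that of a term. -/
lemma exists_w_sum_eq {ι : Type*} (w : Valuation F Γ₀) (s : Finset ι) (f : ι → F)
    (hf : ∀ i ∈ s, ∀ j ∈ s, f i ≠ 0 → w (f i) = w (f j) → i = j) (h0 : w (∑ i ∈ s, f i) ≠ 0) :
    ∃ i ∈ s, w (∑ i ∈ s, f i) = w (f i) := by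
  classical
  induction s using Finset.induction_on with
  | empty => simp at h0
  | insert a s ha ih =>
    rw [sum_insert ha] at h0 ⊢
    have hf' : ∀ i ∈ s, ∀ j ∈ s, f i ≠ 0 → w (f i) = w (f j) → i = j := fun i hi j hj ↦
      hf i (mem_insert_of_mem hi) j (mem_insert_of_mem hj)
    by_cases hs : w (∑ i ∈ s, f i) = 0
    · rw [Valuation.zero_iff] at hs
      exact ⟨a, mem_insert_self _ _, by rw [hs, add_zero]⟩
    · obtain ⟨i, hi, hwi⟩ := ih hf' hs
      have hne : w (f a) ≠ w (∑ i ∈ s, f i) := by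
        intro h
        rw [hwi] at h
        have : f a ≠ 0 := by
          intro h'
          rw [h', map_zero] at h
          exact hs (by rw [hwi, ← h])
        exact ha (hf a (mem_insert_self _ _) i (mem_insert_of_mem hi) this h ▸ hi)
      rw [Valuation.map_add_of_distinct_val w hne]
      rcases le_total (w (f a)) (w (∑ i ∈ s, f i)) with h | h
      · exact ⟨i, mem_insert_of_mem hi, by rw [max_eq_right h, hwi]⟩
      · exact ⟨a, mem_insert_self _ _, by rw [max_eq_left h]⟩

/-- The partial norm `π · σπ ⋯ σ^(k-1)π`, an element of valuation `k` which `σ` moves as deeply as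
`σ ^ k` moves `π`. -/
def partialNorm (σ : G) (π : F) (k : ℕ) : F := ∏ j ∈ range k, σ ^ j • π

lemma smul_partialNorm (σ : G) (π : F) (k : ℕ) :
    (σ • partialNorm σ π k) * π = partialNorm σ π k * σ ^ k • π := by
  rw [partialNorm, ← prod_range_succ, prod_range_succ', smul_prod']
  simp only [pow_zero, one_smul, smul_smul, pow_succ']

namespace TotRam

variable (T : TotRam w G π)
include T

lemma partialNorm_ne_zero (σ : G) (k : ℕ) : partialNorm σ π k ≠ 0 :=
  prod_ne_zero_iff.mpr fun _ _ ↦ ne_zero_of_smul _ T.ne_zero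

lemma w_partialNorm (σ : G) (k : ℕ) : w (partialNorm σ π k) = w π ^ k := by
  simp [partialNorm, T.invariant]

lemma w_smul_partialNorm_sub (σ : G) (k : ℕ) :
    w (σ • partialNorm σ π k - partialNorm σ π k) = w π ^ k * dep w π (σ ^ k) := by
  have : σ • partialNorm σ π k - partialNorm σ π k =
      partialNorm σ π k * (σ ^ k • π / π - 1) := by
    rw [mul_sub, mul_one, ← mul_div_assoc, ← smul_partialNorm, mul_div_cancel_right₀ _ T.ne_zero]
  rw [this, map_mul, T.w_partialNorm, dep]

/-- An element of valuation at least `N` can be expanded to any precision in the partial norms,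
with digits fixed by the group. -/
lemma exists_expansion (σ : G) (N : ℕ) (k : ℕ) (y : F) (hy : w y ≤ w π ^ N) :
    ∃ c : ℕ → F, (∀ j, ∀ g : G, g • c j = c j) ∧ (∀ j, c j = 0 ∨ w (c j) = 1) ∧
      w (y - ∑ j ∈ range k, c j * partialNorm σ π (N + j)) ≤ w π ^ (N + k) := by
  induction k with
  | zero => exact ⟨fun _ ↦ 0, by simp, by simp, by simpa using hy⟩
  | succ k ih =>
    obtain ⟨c, hc, hc1, hcy⟩ := ih
    set r := y - ∑ j ∈ range k, c j * partialNorm σ π (N + j) with hr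
    set X := partialNorm σ π (N + k) with hX
    have hX0 : X ≠ 0 := T.partialNorm_ne_zero σ _
    have hwX : w X = w π ^ (N + k) := T.w_partialNorm σ _
    have hrX : w (r / X) ≤ 1 := by
      rw [map_div₀, hwX]
      exact div_le_one_of_le₀ hcy zero_le
    obtain ⟨d, hd, hd1, hdr⟩ : ∃ d : F, (∀ g : G, g • d = d) ∧ (d = 0 ∨ w d = 1) ∧
        w (r / X - d) < 1 := by
      rcases hrX.lt_or_eq with h | h
      · exact ⟨0, by simp, Or.inl rfl, by simpa using h⟩
      · obtain ⟨d, hd, hdr⟩ := T.residue _ hrX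
        exact ⟨d, hd, Or.inr ((Valuation.map_eq_of_sub_lt w
          (by rwa [h, Valuation.map_sub_swap])).trans h), hdr⟩
    refine ⟨fun j ↦ if j = k then d else c j, ?_, ?_, ?_⟩
    · intro j g
      dsimp only
      split_ifs
      exacts [hd g, hc j g]
    · intro j
      dsimp only
      split_ifs
      exacts [hd1, hc1 j]
    · have : y - ∑ j ∈ range (k + 1), (if j = k then d else c j) * partialNorm σ π (N + j) =
          X * (r / X - d) := by
        rw [sum_range_succ, sum_congr rfl (g := fun j ↦ c j * partialNorm σ π (N + j))]
        · rw [if_pos rfl, mul_sub, mul_div_cancel₀ _ hX0, hr]; ring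
        · intro j hj
          rw [if_neg (mem_range.mp hj).ne]
      rw [this, map_mul, hwX, ← add_assoc, pow_succ]
      exact mul_le_mul_right (T.le_of_lt_one hdr) _

variable {p : ℕ}

/-- In a cyclic group of `p`-power order, the depth of a power depends only on the `p`-adic
valuation of the exponent. -/
lemma dep_pow_mul_eq (hp : p.Prime) {σ : G} {r : ℕ} (hr : ∀ x : F, σ ^ p ^ r • x = x)
    (a : ℕ) {k : ℕ} (hk : ¬ p ∣ k) : dep w π (σ ^ (p ^ a * k)) = dep w π (σ ^ p ^ a) := by
  refine le_antisymm (by rw [pow_mul]; exact T.dep_pow_le _ _) ?_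
  have hcop : IsCoprime (k : ℤ) ((p ^ r : ℕ) : ℤ) :=
    Nat.isCoprime_iff_coprime.mpr (Nat.Coprime.pow_right r
      ((Nat.Prime.coprime_iff_not_dvd hp).mpr hk).symm)
  obtain ⟨u, v, huv⟩ := hcop
  have : σ ^ p ^ a = (σ ^ (p ^ a * k)) ^ u * (σ ^ p ^ r) ^ ((p ^ a : ℕ) * v : ℤ) := by
    rw [← zpow_natCast, ← zpow_natCast, ← zpow_natCast, ← zpow_mul, ← zpow_mul, ← zpow_add]
    congr 1
    push_cast at huv ⊢
    linear_combination (-(p : ℤ) ^ a) * huv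
  rw [this]
  refine (T.dep_mul_le _ _).trans (max_le (T.dep_zpow_le _ _) ?_)
  refine (T.dep_zpow_le _ _).trans ?_
  rw [T.dep_eq_zero_iff.mpr hr]
  exact zero_le

lemma dep_pow_eq_padicValNat (hp : p.Prime) {σ : G} {r : ℕ} (hr : ∀ x : F, σ ^ p ^ r • x = x)
    {k : ℕ} (hk : k ≠ 0) : dep w π (σ ^ k) = dep w π (σ ^ p ^ padicValNat p k) := by
  obtain ⟨a, m, hm, rfl⟩ := Nat.exists_eq_pow_mul_and_not_dvd hk p hp.ne_one
  have : Fact p.Prime := ⟨hp⟩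
  have hm0 : m ≠ 0 := by rintro rfl; simp at hm
  rw [padicValNat.mul (pow_ne_zero _ hp.ne_zero) hm0, padicValNat.prime_pow,
    padicValNat.eq_zero_of_not_dvd hm, add_zero, T.dep_pow_mul_eq hp hr a hm]

/-- If the breaks of `σ, σ^p, …, σ^(p^(n-1))` satisfy Sen's congruences, then every integer
congruent modulo `p ^ n` to the break of `σ ^ p ^ (n-1)` is missed by the valuations of `σ X - X`
for the partial norms `X` of valuation prime to `p ^ n`. Hence no large element can be moved by
`σ` to such a valuation. -/
lemma not_large_of_w_smul_sub (hp : p.Prime) {σ : G} {r : ℕ} (hr : ∀ x : F, σ ^ p ^ r • x = x)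
    {n : ℕ} (hn : 1 ≤ n) {i : ℕ → ℤ} (hi : ∀ a ≤ n, dep w π (σ ^ p ^ a) = w π ^ i a)
    (hin : 0 ≤ i n)
    (hcong : ∀ a, 1 ≤ a → a < n → (p : ℤ) ^ a ∣ i a - i (a - 1))
    {m : ℕ} (hm : (p : ℤ) ^ n ∣ m + i n - i (n - 1)) {y : F} (hy : w y < w π ^ m)
    (hσy : w (σ • y - y) = w π ^ (m + i n)) : False := by
  have : Fact p.Prime := ⟨hp⟩
  have htel : ∀ a b, a ≤ b → b < n → (p : ℤ) ^ (a + 1) ∣ i b - i a := by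
    intro a b hab
    induction b, hab using Nat.le_induction with
    | base => simp
    | succ b hab ih =>
      intro hb
      have h1 := hcong (b + 1) (by omega) hb
      have h2 : (p : ℤ) ^ (a + 1) ∣ i (b + 1) - i b :=
        (pow_dvd_pow _ (show a + 1 ≤ b + 1 by omega)).trans (by simpa using h1)
      have := dvd_add h2 (ih (by omega))
      simpa using this
  obtain ⟨l, hl⟩ := Int.eq_ofNat_of_zero_le hin
  have hy' : w y ≤ w π ^ (m + 1) := by
    have := T.le_zpow_succ (k := m) (by simpa using hy)
    exact_mod_cast this
  -- With `i n` digits the remainder is too small to contribute to `σ • y - y`.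
  obtain ⟨c, hc, hc1, hcr⟩ := T.exists_expansion σ (m + 1) l y hy'
  set s := y - ∑ j ∈ range l, c j * partialNorm σ π (m + 1 + j) with hs
  set f : ℕ → F := fun j ↦ c j * (σ • partialNorm σ π (m + 1 + j) - partialNorm σ π (m + 1 + j))
    with hf
  have hsum : σ • y - y = ∑ j ∈ range l with ¬ p ^ n ∣ m + 1 + j, f j +
      (∑ j ∈ range l with p ^ n ∣ m + 1 + j, f j + (σ • s - s)) := by
    have hy : y = ∑ j ∈ range l, c j * partialNorm σ π (m + 1 + j) + s := by rw [hs]; ring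
    rw [← add_assoc, add_comm (∑ j ∈ range l with ¬ p ^ n ∣ m + 1 + j, f j),
      sum_filter_add_sum_filter_not, hy, smul_add, smul_sum]
    simp only [smul_mul', hc, hf, mul_sub, sum_sub_distrib]
    ring
  have hwf : ∀ j, c j ≠ 0 → w (f j) = w π ^ (m + 1 + j) * dep w π (σ ^ (m + 1 + j)) := by
    intro j hj
    rw [hf, map_mul, (hc1 j).resolve_left hj, one_mul, T.w_smul_partialNorm_sub]
  -- Digits at indices divisible by `p ^ n` contribute too little as `y` is smaller than `π ^ m`.
  have hB : w (∑ j ∈ range l with p ^ n ∣ m + 1 + j, f j + (σ • s - s)) < w π ^ (m + i n) := by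
    refine w.map_add_lt (w.map_sum_lt (zpow_ne_zero _ T.w_ne_zero) ?_) ?_
    · intro j hj
      rw [mem_filter] at hj
      by_cases hcj : c j = 0
      · simpa [hf, hcj] using zpow_pos T.pos _
      · rw [hwf j hcj]
        obtain ⟨q, hq⟩ := hj.2
        have h1 : dep w π (σ ^ (m + 1 + j)) ≤ w π ^ i n := by
          rw [hq, pow_mul, ← hi n le_rfl]
          exact T.dep_pow_le _ _
        refine (mul_le_mul_right h1 _).trans_lt ?_
        rw [← zpow_natCast, ← zpow_add₀ T.w_ne_zero, T.zpow_lt_zpow_iff]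
        push_cast
        omega
    · refine (w.map_sub _ _).trans_lt ?_
      rw [T.invariant, max_self]
      refine hcr.trans_lt ?_
      rw [← zpow_natCast, T.zpow_lt_zpow_iff]
      push_cast
      omega
  have hA : w (∑ j ∈ range l with ¬ p ^ n ∣ m + 1 + j, f j) = w π ^ (m + i n) := by
    rw [← hσy] at hB ⊢
    rw [← Valuation.map_sub_eq_of_lt_left w hB, hsum, add_sub_cancel_right]
  have hlev : ∀ j, ¬ p ^ n ∣ m + 1 + j → padicValNat p (m + 1 + j) < n := by
    intro j hj
    by_contra h
    exact hj ((padicValNat_dvd_iff_le (by omega)).mpr (not_lt.mp h))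
  have hwf' : ∀ j, ¬ p ^ n ∣ m + 1 + j → c j ≠ 0 →
      w (f j) = w π ^ ((m + 1 + j : ℕ) + i (padicValNat p (m + 1 + j))) := by
    intro j hj hcj
    rw [hwf j hcj, T.dep_pow_eq_padicValNat hp hr (by omega), hi _ (hlev j hj).le,
      zpow_add₀ T.w_ne_zero, zpow_natCast]
  have hfc : ∀ j, f j ≠ 0 → c j ≠ 0 := by
    intro j hj h
    simp [hf, h] at hj
  have hvM : ∀ M : ℕ, M ≠ 0 → ¬ (p : ℤ) ^ (padicValNat p M + 1) ∣ M := by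
    intro M hM h
    have := (padicValNat_dvd_iff_le (p := p) hM).mp (by exact_mod_cast h)
    omega
  -- Equal valuations at different levels `a < b` would force `p ^ (a + 1)` to divide both indices.
  have hinj : ∀ j ∈ {j ∈ range l | ¬ p ^ n ∣ m + 1 + j},
      ∀ j' ∈ {j ∈ range l | ¬ p ^ n ∣ m + 1 + j}, f j ≠ 0 → w (f j) = w (f j') → j = j' := by
    intro j hj j' hj' hfj hjj'
    rw [mem_filter] at hj hj'
    have hcj := hfc j hfj
    have hcj' : c j' ≠ 0 := by
      refine hfc j' fun h ↦ hfj ?_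
      rwa [h, map_zero, Valuation.zero_iff] at hjj'
    rw [hwf' j hj.2 hcj, hwf' j' hj'.2 hcj'] at hjj'
    have h1 := T.zpow_inj hjj'
    have key : ∀ j j' : ℕ, ¬ p ^ n ∣ m + 1 + j' →
        ((m + 1 + j : ℕ) : ℤ) + i (padicValNat p (m + 1 + j)) =
        (m + 1 + j' : ℕ) + i (padicValNat p (m + 1 + j')) →
        ¬ padicValNat p (m + 1 + j) < padicValNat p (m + 1 + j') := by
      intro j j' hj' h1 hlt
      have h2 := htel _ _ hlt.le (hlev j' hj')
      have h3 : (p : ℤ) ^ (padicValNat p (m + 1 + j) + 1) ∣ ((m + 1 + j' : ℕ) : ℤ) := by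
        exact_mod_cast (padicValNat_dvd_iff_le (by omega)).mpr hlt
      refine hvM (m + 1 + j) (by omega) ?_
      have h4 : ((m + 1 + j : ℕ) : ℤ) = i (padicValNat p (m + 1 + j')) -
          i (padicValNat p (m + 1 + j)) + (m + 1 + j' : ℕ) := by omega
      rw [h4]
      exact dvd_add h2 h3
    have h4 : padicValNat p (m + 1 + j) = padicValNat p (m + 1 + j') :=
      le_antisymm (not_lt.mp (key j' j hj.2 h1.symm)) (not_lt.mp (key j j' hj'.2 h1))
    rw [h4] at h1
    omega
  obtain ⟨j, hj, hwj⟩ := exists_w_sum_eq w _ f hinj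
    (by rw [hA]; exact zpow_ne_zero _ T.w_ne_zero)
  rw [mem_filter] at hj
  have hcj : c j ≠ 0 := by
    refine hfc j fun h ↦ ?_
    rw [hA, h, map_zero] at hwj
    exact zpow_ne_zero _ T.w_ne_zero hwj
  rw [hA, hwf' j hj.2 hcj] at hwj
  have h1 := T.zpow_inj hwj
  set a := padicValNat p (m + 1 + j) with ha
  have han : a < n := hlev j hj.2
  have h2 := htel a (n - 1) (by omega) (by omega)
  have h3 : (p : ℤ) ^ (a + 1) ∣ m + i n - i (n - 1) := (pow_dvd_pow _ (by omega)).trans hm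
  refine hvM (m + 1 + j) (by omega) ?_
  rw [← ha]
  have h4 : ((m + 1 + j : ℕ) : ℤ) = i (n - 1) - i a + (m + i n - i (n - 1)) := by linarith
  rw [h4]
  exact dvd_add h2 h3

/-- The trace-like sum `z + σ z + ⋯ + σ^(p-1) z` is smaller than `z` when `σ` is wild and `p` is the
residue characteristic. -/
lemma w_sum_smul_lt (hwp : w (p : F) < 1) {σ : G} (hσ : dep w π σ < 1) {z : F} (hz : z ≠ 0) :
    w (∑ j ∈ range p, σ ^ j • z) < w z := by
  have hz' : w z ≠ 0 := (Valuation.ne_zero_iff w).mpr hz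
  have : ∑ j ∈ range p, σ ^ j • z = p * z + ∑ j ∈ range p, (σ ^ j • z - z) := by
    rw [sum_sub_distrib, sum_const, card_range, nsmul_eq_mul]; ring
  rw [this]
  refine w.map_add_lt ?_ (w.map_sum_lt hz' fun j _ ↦ ?_)
  · rw [map_mul]
    exact mul_lt_of_lt_one_left (zero_lt_iff.mpr hz') hwp
  · refine (T.smul_sub_le_mul _ _).trans_lt ?_
    exact mul_lt_of_lt_one_right (zero_lt_iff.mpr hz') ((T.dep_pow_le _ _).trans_lt hσ)

/-- **Sen's theorem** for an automorphism of `p`-power order. -/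
theorem sen (hp : p.Prime) (hwp : w (p : F) < 1) (n : ℕ) (hn : 1 ≤ n) {σ : G} {r : ℕ}
    (hr : ∀ x : F, σ ^ p ^ r • x = x) (hσ : dep w π σ < 1) (hσn : dep w π (σ ^ p ^ n) ≠ 0) :
    (p : ℤ) ^ n ∣ brk w π (σ ^ p ^ n) - brk w π (σ ^ p ^ (n - 1)) := by
  induction n using Nat.strong_induction_on generalizing σ with
  | _ n ih =>
  have hle : ∀ a ≤ n, dep w π (σ ^ p ^ n) ≤ dep w π (σ ^ p ^ a) := by
    intro a ha
    obtain ⟨b, rfl⟩ := Nat.exists_eq_add_of_le ha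
    rw [pow_add p, pow_mul]
    exact T.dep_pow_le _ _
  have hne : ∀ a ≤ n, dep w π (σ ^ p ^ a) ≠ 0 := fun a ha h ↦
    hσn (le_zero_iff.mp ((hle a ha).trans h.le))
  have hi : ∀ a ≤ n, dep w π (σ ^ p ^ a) = w π ^ brk w π (σ ^ p ^ a) := fun a ha ↦
    T.dep_eq (hne a ha)
  have hpos : 0 ≤ brk w π (σ ^ p ^ n) := by
    have := T.dep_le_one (σ ^ p ^ n)
    rw [hi n le_rfl, ← zpow_zero (w π), T.zpow_le_zpow_iff] at this
    exact this
  have hcong : ∀ a, 1 ≤ a → a < n →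
      (p : ℤ) ^ a ∣ brk w π (σ ^ p ^ a) - brk w π (σ ^ p ^ (a - 1)) :=
    fun a ha han ↦ ih a han ha hr hσ (hne a han.le)
  by_contra hnd
  set d := brk w π (σ ^ p ^ (n - 1)) - brk w π (σ ^ p ^ n) with hd
  have hpn : (0 : ℤ) < (p : ℤ) ^ n := pow_pos (by exact_mod_cast hp.pos) n
  -- The congruence modulo `p ^ (n - 1)` comes from the inductive hypothesis for `σ ^ p`.
  have hd1 : (p : ℤ) ^ (n - 1) ∣ d := by
    rcases Nat.lt_or_ge 1 n with h | h
    · have hs : ∀ a, (σ ^ p) ^ p ^ a = σ ^ p ^ (a + 1) := fun a ↦ by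
        rw [← pow_mul, ← pow_succ']
      have := ih (n - 1) (by omega) (by omega) (σ := σ ^ p)
        (fun x ↦ by
          rw [← pow_mul, mul_comm, pow_mul]
          exact (T.dep_eq_zero_iff (g := (σ ^ p ^ r) ^ p)).mp (le_zero_iff.mp
            ((T.dep_pow_le _ _).trans (T.dep_eq_zero_iff.mpr hr).le)) x)
        ((T.dep_pow_le _ _).trans_lt hσ)
        (by rw [hs, show n - 1 + 1 = n by omega]; exact hσn)
      rw [hs, hs, show n - 1 + 1 = n by omega, show n - 1 - 1 + 1 = n - 1 by omega] at this
      rw [hd, ← neg_sub]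
      exact (dvd_neg).mpr this
    · rw [show n - 1 = 0 by omega, pow_zero]
      exact one_dvd _
  -- A natural number `m ≡ d` modulo `p ^ n` is exactly divisible by `p ^ (n - 1)`, so the partial
  -- norm of `σ ^ p` of valuation `m` is moved by `σ ^ p` to valuation `m` plus the break of
  -- `σ ^ p ^ n`.
  obtain ⟨m, hm⟩ := Int.eq_ofNat_of_zero_le (Int.emod_nonneg d hpn.ne')
  have hmd : (p : ℤ) ^ n ∣ m - d := by
    rw [← hm, ← dvd_neg, neg_sub]
    exact Int.dvd_self_sub_emod
  have hm1 : (p : ℤ) ^ (n - 1) ∣ m := by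
    have := dvd_add ((pow_dvd_pow (p : ℤ) (Nat.sub_le n 1)).trans hmd) hd1
    simpa using this
  have hmn : ¬ (p : ℤ) ^ n ∣ m := by
    intro h
    apply hnd
    have := dvd_sub hmd h
    rw [hd] at this
    simpa using this
  obtain ⟨q, rfl⟩ : p ^ (n - 1) ∣ m := by exact_mod_cast hm1
  have hq : ¬ p ∣ q := by
    rintro ⟨q', rfl⟩
    apply hmn
    rw [← mul_assoc, ← pow_succ, show n - 1 + 1 = n by omega]
    push_cast
    exact dvd_mul_right _ _
  set m := p ^ (n - 1) * q with hmdef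
  set z := partialNorm (σ ^ p) π m with hz
  have hz0 : z ≠ 0 := T.partialNorm_ne_zero _ _
  have hpm : p * m = p ^ n * q := by
    rw [hmdef, ← mul_assoc, ← pow_succ', show n - 1 + 1 = n by omega]
  refine T.not_large_of_w_smul_sub hp hr hn hi hpos hcong (m := m) ?_
    (y := ∑ j ∈ range p, σ ^ j • z) ?_ ?_
  · rw [hd] at hmd
    convert hmd using 1
    ring
  · rw [← T.w_partialNorm (σ ^ p) m]
    exact T.w_sum_smul_lt hwp hσ hz0
  · have : σ • ∑ j ∈ range p, σ ^ j • z - ∑ j ∈ range p, σ ^ j • z = σ ^ p • z - z := by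
      rw [smul_sum]
      simp only [smul_smul, ← pow_succ']
      rw [← sum_sub_distrib, sum_range_sub (fun j ↦ σ ^ j • z)]
      simp
    rw [this, hz, T.w_smul_partialNorm_sub, ← pow_mul, hpm, T.dep_pow_mul_eq hp hr n hq,
      hi n le_rfl, zpow_add₀ T.w_ne_zero, zpow_natCast]

end TotRam

end

/-! ### The ramification index of a totally ramified action -/

section

variable {F Γ₀ G : Type*} [Field F] [LinearOrderedCommGroupWithZero Γ₀] {w : Valuation F Γ₀}
  [Group G] [MulSemiringAction G F] {π : F}

namespace TotRam

/-- The group of valuations, in units of `w π`, of the elements fixed by the group. -/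
def fixedValues (T : TotRam w G π) : AddSubgroup ℤ where
  carrier := {k | ∃ c : F, (∀ g : G, g • c = c) ∧ w c = w π ^ k}
  zero_mem' := ⟨1, by simp⟩
  add_mem' := by
    rintro a b ⟨c, hc, hca⟩ ⟨d, hd, hdb⟩
    exact ⟨c * d, fun g ↦ by rw [smul_mul', hc, hd],
      by rw [map_mul, hca, hdb, zpow_add₀ T.w_ne_zero]⟩
  neg_mem' := by
    rintro a ⟨c, hc, hca⟩
    exact ⟨c⁻¹, fun g ↦ by rw [smul_inv'', hc], by rw [map_inv₀, hca, zpow_neg]⟩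

variable (T : TotRam w G π)
include T

/-- Modulo the kernel of a map that is linear over the fixed field and kills `1, π, …, π^(e-1)`,
every element can be made arbitrarily small when the fixed elements realize all multiples of `e` as
valuations. -/
lemma exists_small_of_kills {e : ℕ} (he : 0 < e) (heT : (e : ℤ) ∈ T.fixedValues) (D : F →+ F)
    (hD : ∀ c : F, (∀ g : G, g • c = c) → ∀ j < e, D (c * π ^ j) = 0) (N : ℕ) (y : F) :
    ∃ z, D z = D y ∧ w z ≤ w y * w π ^ N := by
  induction N with
  | zero => exact ⟨y, rfl, by simp⟩
  | succ N ih =>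
    obtain ⟨z, hz, hzN⟩ := ih
    by_cases hz0 : z = 0
    · exact ⟨0, by rw [← hz, hz0], by simp⟩
    obtain ⟨k, hk⟩ := T.exists_zpow z hz0
    have he' : (e : ℤ) ≠ 0 := by omega
    obtain ⟨j, hj⟩ := Int.eq_ofNat_of_zero_le (Int.emod_nonneg k he')
    have hje : j < e := by
      have := Int.emod_lt_of_pos k (show (0 : ℤ) < e by omega)
      omega
    obtain ⟨c, hc, hck⟩ : k / e * e ∈ T.fixedValues := by
      simpa using T.fixedValues.zsmul_mem heT (k / e)
    have hcj : w (c * π ^ j) = w z := by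
      rw [map_mul, hck, map_pow, ← zpow_natCast, ← zpow_add₀ T.w_ne_zero, hk, ← hj,
        mul_comm, Int.mul_ediv_add_emod]
    have hcj0 : c * π ^ j ≠ 0 := by
      rw [← Valuation.ne_zero_iff w, hcj]
      exact (Valuation.ne_zero_iff w).mpr hz0
    obtain ⟨d, hd, hdz⟩ := T.residue (z / (c * π ^ j)) (by
      rw [map_div₀, hcj, div_self ((Valuation.ne_zero_iff w).mpr hz0)])
    refine ⟨z - d * c * π ^ j, ?_, ?_⟩
    · rw [map_sub, hD _ (fun g ↦ by rw [smul_mul', hd, hc]) j hje, sub_zero, hz]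
    · have : z - d * c * π ^ j = (c * π ^ j) * (z / (c * π ^ j) - d) := by
        rw [mul_sub, mul_div_cancel₀ _ hcj0]; ring
      rw [this, map_mul, hcj, pow_succ, ← mul_assoc]
      exact mul_le_mul' hzN (T.le_of_lt_one hdz)

/-- For a faithful totally ramified action of a finite group `G`, the valuations of the fixed
elements are multiples of `|G|`. Otherwise the fixed span of `1, π, …, π^(e-1)` with `e < |G|` would
be dense, and a nontrivial linear relation between the elements of `G` on that span would extend to
the whole field, against Dedekind's independence of characters. -/
theorem card_dvd_of_mem_fixedValues [Finite G] [FaithfulSMul G F] {k : ℤ}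
    (hk : k ∈ T.fixedValues) : (Nat.card G : ℤ) ∣ k := by
  classical
  cases nonempty_fintype G
  obtain ⟨a, ha⟩ := Int.subgroup_cyclic T.fixedValues
  have hmem : ∀ k, k ∈ T.fixedValues ↔ a ∣ k := fun k ↦ by
    rw [ha, ← AddSubgroup.zmultiples_eq_closure, Int.mem_zmultiples_iff]
  have hcard : (Nat.card G : ℤ) ∈ T.fixedValues := by
    refine ⟨∏ g : G, g • π, fun h ↦ ?_, ?_⟩
    · rw [smul_prod']
      simp only [smul_smul]
      exact Fintype.prod_equiv (Equiv.mulLeft h) _ _ fun _ ↦ rfl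
    · simp [T.invariant, Nat.card_eq_fintype_card]
  have hGpos : 0 < Nat.card G := Nat.card_pos
  have hdvd : a.natAbs ∣ Nat.card G := Int.natAbs_dvd_natAbs.mpr ((hmem _).mp hcard)
  have hepos : 0 < a.natAbs := Nat.pos_of_dvd_of_pos hdvd hGpos
  have heT : (a.natAbs : ℤ) ∈ T.fixedValues := (hmem _).mpr (Int.dvd_natAbs.mpr dvd_rfl)
  rcases (Nat.le_of_dvd hGpos hdvd).eq_or_lt with h | h
  · rw [← h]
    exact Int.natAbs_dvd.mpr ((hmem _).mp hk)
  exfalso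
  set e := a.natAbs
  let M : Matrix (Fin e) G F := fun j g ↦ g • π ^ (j : ℕ)
  obtain ⟨b, hbM, hb0⟩ : ∃ b ∈ LinearMap.ker M.mulVecLin, b ≠ 0 := by
    refine Submodule.exists_mem_ne_zero_of_ne_bot (LinearMap.ker_ne_bot_of_finrank_lt ?_)
    simpa [Nat.card_eq_fintype_card] using h
  let D : F →+ F :=
    { toFun y := ∑ g : G, b g * g • y
      map_zero' := by simp
      map_add' x y := by simp [mul_add, sum_add_distrib] }
  have hDdef : ∀ y, D y = ∑ g : G, b g * g • y := fun _ ↦ rfl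
  have hD : ∀ c : F, (∀ g : G, g • c = c) → ∀ j < e, D (c * π ^ j) = 0 := by
    intro c hc j hj
    have h1 : ∑ g : G, g • π ^ j * b g = 0 := congrFun (LinearMap.mem_ker.mp hbM) ⟨j, hj⟩
    rw [hDdef, ← mul_zero c, ← h1, mul_sum]
    refine sum_congr rfl fun g _ ↦ ?_
    rw [smul_mul', hc]; ring
  obtain ⟨g₀, -, hg₀⟩ := exists_max_image univ (fun g ↦ w (b g)) ⟨1, mem_univ _⟩
  have hDzero : ∀ y, ∑ g : G, b g * g • y = 0 := by
    intro y
    refine T.eq_zero_of_le_pow (z := b g₀ * y) rfl fun N ↦ ?_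
    obtain ⟨z, hz, hzN⟩ := T.exists_small_of_kills hepos heT D hD N y
    rw [← hDdef, ← hz, hDdef, map_mul, mul_assoc]
    refine w.map_sum_le fun g hg ↦ ?_
    rw [map_mul, T.invariant]
    exact mul_le_mul' (hg₀ g hg) hzN
  have hinj : Function.Injective
      (fun g : G ↦ ((MulSemiringAction.toRingHom G F g : F →+* F) : F →* F)) := by
    intro g h hgh
    refine FaithfulSMul.eq_of_smul_eq_smul (α := F) fun x ↦ ?_
    exact DFunLike.congr_fun hgh x
  have hli := (linearIndependent_monoidHom F F).comp _ hinj
  rw [Fintype.linearIndependent_iff] at hli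
  refine hb0 (funext fun g ↦ hli b ?_ g)
  funext y
  simpa using hDzero y

end TotRam

/-! ### Quotients of the ramification filtration -/

lemma w_coeff_prod_X_sub_C_le_one {ι : Type*} (w : Valuation F Γ₀) (s : Finset ι) (a : ι → F)
    (ha : ∀ i ∈ s, w (a i) ≤ 1) (n : ℕ) :
    w ((∏ i ∈ s, (Polynomial.X - Polynomial.C (a i))).coeff n) ≤ 1 := by
  classical
  induction s using Finset.induction_on generalizing n with
  | empty =>
    rw [prod_empty, Polynomial.coeff_one]
    split_ifs <;> simp
  | insert i s hi ih =>
    have ih' := ih fun j hj ↦ ha j (mem_insert_of_mem hj)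
    rw [prod_insert hi, sub_mul, Polynomial.coeff_sub, Polynomial.coeff_C_mul]
    refine (w.map_sub _ _).trans (max_le ?_ ?_)
    · cases n with
      | zero => simp
      | succ n => rw [Polynomial.coeff_X_mul]; exact ih' n
    · rw [map_mul]
      exact mul_le_one' (ha i (mem_insert_self _ _)) (ih' n)

section Quotient

variable {P : Type*} [CommGroup P] [MulSemiringAction P F]

/-- The fixed field of a subgroup of a commutative group is stable under the whole group. -/
instance (H : Subgroup P) : IsInvariantSubfield P (FixedPoints.subfield H F) where
  smul_mem g {x} hx h := by
    have := hx h
    rw [Subgroup.smul_def] at this ⊢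
    rw [smul_comm, this]

variable (H : Subgroup P) [Fintype H]

/-- The norm of the uniformizer, a uniformizer of the fixed field of `H`. -/
def fixedUniformizer (π : F) : FixedPoints.subfield H F :=
  ⟨∏ h : H, h • π, fun h ↦ by
    rw [smul_prod']
    simp only [smul_smul]
    exact Fintype.prod_equiv (Equiv.mulLeft h) _ _ fun _ ↦ rfl⟩

lemma coe_fixedUniformizer (π : F) :
    (fixedUniformizer H π : F) = ∏ h : H, h • π := rfl

namespace TotRam

variable (T : TotRam w P π)
include T

lemma w_fixedUniformizer : w (fixedUniformizer H π : F) = w π ^ Fintype.card H := by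
  simp [coe_fixedUniformizer, (T.restrict H).invariant]

/-- The action on the fixed field of a subgroup is totally ramified. -/
lemma fixed [Finite P] [FaithfulSMul P F] :
    TotRam (w.comap (FixedPoints.subfield H F).subtype) P (fixedUniformizer H π) where
  lt_one := by
    simpa [T.w_fixedUniformizer H] using
      pow_lt_one₀ zero_le T.lt_one (Fintype.card_ne_zero (α := H))
  ne_zero := by
    intro h
    have := T.w_fixedUniformizer H
    rw [h, ZeroMemClass.coe_zero, map_zero] at this
    exact pow_ne_zero _ T.w_ne_zero this.symm
  exists_zpow x hx := by
    have hx' : (x : F) ≠ 0 := fun h ↦ hx (Subtype.ext h)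
    obtain ⟨k, hk⟩ := T.exists_zpow x hx'
    obtain ⟨m, rfl⟩ := (T.restrict H).card_dvd_of_mem_fixedValues (k := k) ⟨x, x.2, hk⟩
    refine ⟨m, ?_⟩
    simp only [Valuation.comap_apply, Subfield.coe_subtype, T.w_fixedUniformizer H]
    rw [hk, zpow_mul, zpow_natCast, Nat.card_eq_fintype_card]
  invariant g x := T.invariant g x
  residue x hx := by
    obtain ⟨c, hc, hxc⟩ := T.residue x hx
    exact ⟨⟨c, fun h ↦ hc h⟩, fun g ↦ Subtype.ext (hc g), hxc⟩

/-- The depth of `s` on the fixed field of `H` is the product of the depths of the coset `sH`. The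
conjugate by `s` of the characteristic polynomial of `π` over the fixed field, evaluated at `π`, is
dominated by the change of its constant coefficient. -/
theorem w_smul_fixedUniformizer_sub [Finite P] [FaithfulSMul P F] (s : P) :
    w (s • (fixedUniformizer H π : F) - fixedUniformizer H π) =
      ∏ h : H, w ((s * h) • π - π) := by
  set f : Polynomial F := ∏ h : H, (Polynomial.X - Polynomial.C (h • π)) with hf
  have hmap : ∀ g : P, f.map (MulSemiringAction.toRingHom P F g) =
      ∏ h : H, (Polynomial.X - Polynomial.C (g • h • π)) := by
    intro g
    simp [hf, Polynomial.map_prod]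
  have hfix : ∀ n, ∀ h : H, h • f.coeff n = f.coeff n := fun n h ↦
    MulSemiringAction.smul_coeff_charpoly π n h
  have hf1 : ∀ n, w (f.coeff n) ≤ 1 := w_coeff_prod_X_sub_C_le_one w _ _ fun h _ ↦ by
    rw [(T.restrict H).invariant]; exact T.lt_one.le
  set q := f.map (MulSemiringAction.toRingHom P F s) - f with hq
  have hqc : ∀ n, q.coeff n = s • f.coeff n - f.coeff n := fun n ↦ by
    rw [hq, Polynomial.coeff_sub, Polynomial.coeff_map]; rfl
  set D := w (s • (fixedUniformizer H π : F) - fixedUniformizer H π) with hD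
  have hqD : ∀ n, w (q.coeff n) ≤ D := fun n ↦ by
    rw [hqc]
    exact (T.fixed H).smul_sub_le s (a := ⟨f.coeff n, hfix n⟩) (hf1 n)
  have hq0 : w (q.coeff 0) = D := by
    have h0 : f.coeff 0 = (-1) ^ Fintype.card H * (fixedUniformizer H π : F) := by
      rw [hf, Polynomial.coeff_zero_eq_eval_zero, Polynomial.eval_prod, coe_fixedUniformizer]
      simp [prod_neg]
    rw [hqc, h0, smul_mul', smul_pow', smul_neg, smul_one, ← mul_sub, map_mul, map_pow,
      Valuation.map_neg, map_one, one_pow, one_mul]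
  have heval : q.eval π = ∏ h : H, (π - (s * h) • π) := by
    have h1 : f.eval π = 0 := MulSemiringAction.eval_charpoly H π
    rw [hq, Polynomial.eval_sub, h1, sub_zero, hmap, Polynomial.eval_prod]
    refine prod_congr rfl fun h _ ↦ ?_
    simp [mul_smul, Subgroup.smul_def]
  have hprod : ∏ h : H, w ((s * h) • π - π) = w (q.eval π) := by
    rw [heval, map_prod]
    exact prod_congr rfl fun h _ ↦ Valuation.map_sub_swap _ _ _
  rw [hprod, Polynomial.eval_eq_sum_range' (Nat.lt_succ_self _), sum_range_succ', pow_zero, mul_one]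
  by_cases hD0 : D = 0
  · have : q = 0 := by
      ext n
      have := hqD n
      rw [hD0, le_zero_iff, Valuation.zero_iff] at this
      simpa using this
    simp [this, hD0]
  · rw [Valuation.map_add_eq_of_lt_right, hq0]
    rw [hq0]
    refine w.map_sum_lt hD0 fun n _ ↦ ?_
    rw [map_mul, map_pow]
    refine (mul_le_mul' (hqD _) (pow_le_of_le_one zero_le T.lt_one.le n.succ_ne_zero)).trans_lt ?_
    exact mul_lt_of_lt_one_right (zero_lt_iff.mpr hD0) T.lt_one

/-- The depth on the fixed field of `H` is the product of the depths over the coset. -/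
theorem dep_fixed [Finite P] [FaithfulSMul P F] (s : P) :
    dep (w.comap (FixedPoints.subfield H F).subtype) (fixedUniformizer H π) s =
      ∏ h : H, dep w π (s * h) := by
  have h1 := T.w_smul_fixedUniformizer_sub H s
  have h2 := (T.fixed H).w_smul_sub s
  simp only [T.w_smul_sub, prod_mul_distrib, prod_const, card_univ] at h1
  have h3 : (w.comap (FixedPoints.subfield H F).subtype) (fixedUniformizer H π) =
    w π ^ Fintype.card H := T.w_fixedUniformizer H
  rw [h3] at h2
  refine mul_left_cancel₀ (pow_ne_zero (Fintype.card H) T.w_ne_zero) ?_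
  rw [← h1, ← h2]
  rfl

end TotRam

end Quotient

end

/-! ### Sums of breaks of cyclic groups -/

lemma sum_range_mul_of_periodic {M : Type*} [AddCommMonoid M] (f : ℕ → M) (q : ℕ)
    (hf : ∀ k, f (q + k) = f k) (n : ℕ) :
    ∑ k ∈ range (n * q), f k = n • ∑ k ∈ range q, f k := by
  induction n with
  | zero => simp
  | succ n ih =>
    rw [add_mul, one_mul, add_comm, sum_range_add, sum_congr rfl fun k _ ↦ hf k, ih, succ_nsmul']

lemma padicValNat_mod_pow {p : ℕ} (hp : p.Prime) {r k : ℕ} (h : ¬ p ^ r ∣ k) :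
    padicValNat p (k % p ^ r) = padicValNat p k := by
  have : Fact p.Prime := ⟨hp⟩
  have hk0 : k ≠ 0 := by rintro rfl; simp at h
  have hk0' : k % p ^ r ≠ 0 := fun h' ↦ h (Nat.dvd_of_mod_eq_zero h')
  have h1 : ∀ n ≤ r, (n ≤ padicValNat p (k % p ^ r) ↔ n ≤ padicValNat p k) := by
    intro n hn
    rw [← padicValNat_dvd_iff_le hk0', ← padicValNat_dvd_iff_le hk0,
      Nat.dvd_mod_iff (pow_dvd_pow p hn)]
  have h2 : ¬ r ≤ padicValNat p k := by rwa [← padicValNat_dvd_iff_le hk0]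
  have h3 := (h1 r le_rfl).not.mpr h2
  exact le_antisymm ((h1 _ (by omega)).mp le_rfl) ((h1 _ (by omega)).mpr le_rfl)

/-- Sen's congruences make the sum of the breaks of a cyclic group of order `p ^ r`, with the break
of the identity replaced by the largest one, divisible by `p ^ r`. -/
lemma pow_dvd_sum_breaks {p : ℕ} (hp : p.Prime) (J : ℕ → ℤ) (r : ℕ)
    (hJ : ∀ n, 1 ≤ n → n ≤ r → (p : ℤ) ^ n ∣ J n - J (n - 1)) :
    (p : ℤ) ^ (r + 1) ∣
      ∑ k ∈ range (p ^ (r + 1)), if k = 0 then J r else J (padicValNat p k) := by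
  have : Fact p.Prime := ⟨hp⟩
  have step : ∀ r, ∑ k ∈ range (p ^ (r + 1)), (if k = 0 then J r else J (padicValNat p k)) =
      p * ∑ k ∈ range (p ^ r), if k = 0 then J r else J (padicValNat p k) := by
    intro r
    set f : ℕ → ℤ := fun k ↦
      if k % p ^ r = 0 then J r else J (padicValNat p (k % p ^ r)) with hf
    have h1 : ∑ k ∈ range (p ^ (r + 1)), (if k = 0 then J r else J (padicValNat p k)) =
        ∑ k ∈ range (p ^ (r + 1)), f k := by
      refine sum_congr rfl fun k hk ↦ ?_
      rw [mem_range] at hk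
      rw [hf]
      dsimp only
      by_cases h : p ^ r ∣ k
      · rw [if_pos (Nat.mod_eq_zero_of_dvd h)]
        split_ifs with hk0
        · rfl
        · have h2 := (padicValNat_dvd_iff_le hk0).mp h
          have h3 : ¬ p ^ (r + 1) ∣ k := fun h' ↦ absurd (Nat.le_of_dvd (by omega) h') (by omega)
          rw [padicValNat_dvd_iff_le hk0] at h3
          rw [show padicValNat p k = r by omega]
      · rw [if_neg (fun h' ↦ h (Nat.dvd_of_mod_eq_zero h')), padicValNat_mod_pow hp h, if_neg]
        rintro rfl
        exact h (dvd_zero _)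
    rw [h1, pow_succ', sum_range_mul_of_periodic f (p ^ r) (fun k ↦ by simp [hf]), nsmul_eq_mul]
    congr 1
    refine sum_congr rfl fun k hk ↦ ?_
    rw [mem_range] at hk
    simp only [hf, Nat.mod_eq_of_lt hk]
  induction r with
  | zero =>
    rw [step]
    simp
  | succ r ih =>
    rw [step, pow_succ' (p : ℤ)]
    refine mul_dvd_mul_left _ ?_
    -- Only the term at `0` depends on the truncation level.
    have h1 : ∑ k ∈ range (p ^ (r + 1)), (if k = 0 then J (r + 1) else J (padicValNat p k)) =
        (J (r + 1) - J r) +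
          ∑ k ∈ range (p ^ (r + 1)), (if k = 0 then J r else J (padicValNat p k)) := by
      rw [← sub_eq_iff_eq_add, ← sum_sub_distrib, sum_eq_single 0]
      · simp
      · intro k _ hk
        simp [hk]
      · intro h
        exact absurd (mem_range.mpr (pow_pos hp.pos _)) h
    rw [h1]
    refine dvd_add (by simpa using hJ (r + 1) (by omega) le_rfl)
      (ih fun n hn hnr ↦ hJ n hn (by omega))

/-! ### Cyclic quotients -/

/-- An element outside a subgroup of a finite commutative group remains nontrivial in some cyclic
quotient by a larger subgroup. -/
lemma exists_cyclic_quotient {P : Type*} [CommGroup P] [Finite P] (N : Subgroup P) {a : P}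
    (ha : a ∉ N) : ∃ H : Subgroup P, N ≤ H ∧ a ∉ H ∧ IsCyclic (P ⧸ H) := by
  obtain ⟨χ, hχ⟩ := CommGroup.exists_apply_ne_one_of_hasEnoughRootsOfUnity (P ⧸ N) ℂ
    (a := (a : P ⧸ N)) (by rwa [Ne, QuotientGroup.eq_one_iff])
  set f : P →* ℂˣ := χ.comp (QuotientGroup.mk' N) with hf
  refine ⟨f.ker, fun x hx ↦ ?_, fun h ↦ hχ h, ?_⟩
  · rw [MonoidHom.mem_ker, hf, MonoidHom.comp_apply, QuotientGroup.mk'_apply,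
      (QuotientGroup.eq_one_iff x).mpr hx, map_one]
  · exact isCyclic_of_injective_ringHom ((Units.coeHom ℂ).comp (QuotientGroup.kerLift f))
      (Units.val_injective.comp (QuotientGroup.kerLift_injective f))

lemma prod_zpow_eq_zpow_sum {Γ₀ ι : Type*} [CommGroupWithZero Γ₀] {γ : Γ₀} (hγ : γ ≠ 0)
    (s : Finset ι) (f : ι → ℤ) : ∏ i ∈ s, γ ^ f i = γ ^ ∑ i ∈ s, f i := by
  classical
  induction s using Finset.induction_on with
  | empty => simp
  | insert a s ha ih => rw [prod_insert ha, sum_insert ha, zpow_add₀ hγ, ih]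

lemma sum_eq_sum_range_sum_subgroup {P M : Type*} [CommGroup P] [Fintype P] [AddCommMonoid M]
    (H : Subgroup P) [Fintype H] {σ : P} (hσ : ∀ x : P ⧸ H, x ∈ Subgroup.zpowers (σ : P ⧸ H))
    (f : P → M) :
    ∑ g, f g = ∑ k ∈ range (Nat.card (P ⧸ H)), ∑ h : H, f (σ ^ k * h) := by
  have hord := orderOf_eq_card_of_forall_mem_zpowers hσ
  rw [← Fin.sum_univ_eq_sum_range (fun k ↦ ∑ h : H, f (σ ^ k * h)), ← Fintype.sum_prod_type']
  refine (Fintype.sum_bijective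
    (fun x : Fin (Nat.card (P ⧸ H)) × H ↦ σ ^ (x.1 : ℕ) * (x.2 : P)) ?_ _ _ fun _ ↦ rfl).symm
  rw [Fintype.bijective_iff_injective_and_card]
  constructor
  · rintro ⟨k, h⟩ ⟨k', h'⟩ hkk'
    simp only at hkk'
    have h1 : (σ : P ⧸ H) ^ (k : ℕ) = (σ : P ⧸ H) ^ (k' : ℕ) := by
      have := congrArg (fun x : P ↦ (x : P ⧸ H)) hkk'
      simpa [(QuotientGroup.eq_one_iff _).mpr h.2, (QuotientGroup.eq_one_iff _).mpr h'.2] using this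
    have h2 : (k : ℕ) = k' := pow_injOn_Iio_orderOf
      (by rw [Set.mem_Iio, hord]; exact k.2) (by rw [Set.mem_Iio, hord]; exact k'.2) h1
    rw [h2] at hkk'
    exact Prod.ext (Fin.ext h2) (Subtype.ext (mul_left_cancel hkk'))
  · rw [Fintype.card_prod, Fintype.card_fin, ← Nat.card_eq_fintype_card,
      ← Nat.card_eq_fintype_card (α := P), ← Subgroup.card_eq_card_quotient_mul_card_subgroup]

/-! ### The sum of truncated breaks -/

section Trunc

variable {F Γ₀ : Type*} [Field F] [LinearOrderedCommGroupWithZero Γ₀] {w : Valuation F Γ₀} {π : F}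

open Classical in
/-- The break of `g` truncated at `t`; the identity, of infinite break, is sent to `t`. -/
noncomputable def truncBrk {G : Type*} [Group G] [MulSemiringAction G F] (w : Valuation F Γ₀)
    (π : F) (t : ℤ) (g : G) : ℤ :=
  if dep w π g < w π ^ t then t else brk w π g

namespace TotRam

lemma zpow_truncBrk {G : Type*} [Group G] [MulSemiringAction G F] (T : TotRam w G π) (t : ℤ)
    (g : G) : w π ^ truncBrk w π t g = max (dep w π g) (w π ^ t) := by
  rw [truncBrk]
  split_ifs with h
  · rw [max_eq_right h.le]
  · rw [max_eq_left (not_lt.mp h), T.dep_eq]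
    exact ((zpow_pos T.pos t).trans_le (not_lt.mp h)).ne'

lemma eq_one_of_dep_eq_zero {G : Type*} [Group G] [MulSemiringAction G F] [FaithfulSMul G F]
    (T : TotRam w G π) {g : G} (h : dep w π g = 0) : g = 1 :=
  FaithfulSMul.eq_of_smul_eq_smul (α := F) fun x ↦ by
    rw [T.dep_eq_zero_iff.mp h, one_smul]

/-- Translation by an element of break `t` does not affect the breaks truncated at `t`. -/
lemma truncBrk_mul_eq {G : Type*} [Group G] [MulSemiringAction G F]
    (T : TotRam w G π) {t : ℤ} {a : G} (hat : dep w π a = w π ^ t) (h : G) :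
    truncBrk w π t (a * h) = truncBrk w π t h := by
  refine T.zpow_inj ?_
  rw [T.zpow_truncBrk, T.zpow_truncBrk]
  rcases lt_or_ge (w π ^ t) (dep w π h) with h' | h'
  · rw [T.dep_mul_eq_right (hat ▸ h')]
  · rw [max_eq_right h', max_eq_right]
    exact (T.dep_mul_le _ _).trans (max_le hat.le h')

variable {P : Type*} [CommGroup P] [MulSemiringAction P F] [FaithfulSMul P F]

/-- The break on the fixed field of `H` is the mean over a coset of the truncated breaks, provided
`H` contains all elements of break greater than `t`. -/
lemma card_mul_brk_fixed [Finite P] (T : TotRam w P π) (H : Subgroup P) [Fintype H] {t : ℤ}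
    (hH : T.depLT t ≤ H) {g : P} (hg : g ∉ H) :
    Fintype.card H * brk (w.comap (FixedPoints.subfield H F).subtype) (fixedUniformizer H π) g =
      ∑ h : H, truncBrk w π t (g * h) := by
  have hgh : ∀ h : H, dep w π (g * h) = w π ^ truncBrk w π t (g * h) := by
    intro h
    rw [T.zpow_truncBrk, max_eq_left]
    refine not_lt.mp fun h' ↦ hg ?_
    simpa using H.mul_mem (hH (T.mem_depLT.mpr h')) (H.inv_mem h.2)
  have h1 := T.dep_fixed H g
  simp only [hgh, prod_zpow_eq_zpow_sum T.w_ne_zero] at h1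
  have h2 := (T.fixed H).dep_eq (g := g) (by rw [h1]; exact zpow_ne_zero _ T.w_ne_zero)
  rw [h1, Valuation.comap_apply, Subfield.coe_subtype, T.w_fixedUniformizer H, ← zpow_natCast,
    ← zpow_mul] at h2
  exact (T.zpow_inj h2).symm

/-- For a wild commutative `p`-group, the integrality statement behind the Hasse–Arf theorem: it is
reduced to Sen's theorem on a cyclic quotient in which the break `t` survives as the largest one. -/
theorem card_dvd_sum_truncBrk_of_isPGroup [Fintype P] (T : TotRam w P π) {p : ℕ} (hp : p.Prime)
    (hwp : w (p : F) < 1) (hP : IsPGroup p P) (hwild : ∀ g : P, dep w π g < 1) {t : ℤ} {a : P}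
    (hat : dep w π a = w π ^ t) : (Nat.card P : ℤ) ∣ ∑ g : P, truncBrk w π t g := by
  classical
  have : Fact p.Prime := ⟨hp⟩
  obtain ⟨H, hH, haH, hcyc⟩ := exists_cyclic_quotient (T.depLT t) (a := a)
    (by rw [T.mem_depLT, hat]; exact lt_irrefl _)
  obtain ⟨σq, hσq⟩ := hcyc.exists_generator
  obtain ⟨σ, rfl⟩ := QuotientGroup.mk_surjective σq
  obtain ⟨r, hr⟩ := (IsPGroup.iff_card (p := p) (G := P ⧸ H)).mp (hP.to_quotient H)
  have hord : orderOf (σ : P ⧸ H) = p ^ r := by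
    rw [orderOf_eq_card_of_forall_mem_zpowers hσq, hr]
  have hmem : ∀ k, σ ^ k ∈ H ↔ p ^ r ∣ k := fun k ↦ by
    rw [← hord, orderOf_dvd_iff_pow_eq_one, ← QuotientGroup.mk_pow, QuotientGroup.eq_one_iff]
  set TF := T.fixed H
  set wF := w.comap (FixedPoints.subfield H F).subtype with hwF
  set πF := fixedUniformizer H π with hπF
  have htriv : ∀ h ∈ H, ∀ x : FixedPoints.subfield H F, h • x = x := fun h hh x ↦
    Subtype.ext (x.2 ⟨h, hh⟩)
  have hdepH : ∀ g : P, g ∉ H → dep wF πF g ≠ 0 := by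
    intro g hg h0
    rw [T.dep_fixed H, prod_eq_zero_iff] at h0
    obtain ⟨h, -, hh⟩ := h0
    apply hg
    rw [eq_inv_of_mul_eq_one_left (T.eq_one_of_dep_eq_zero hh)]
    exact H.inv_mem h.2
  have hσwild : dep wF πF σ < 1 := by
    rw [T.dep_fixed H, ← mul_prod_erase _ _ (mem_univ (1 : H))]
    refine (mul_le_of_le_one_right' (prod_le_one' fun h _ ↦ T.dep_le_one _)).trans_lt (hwild _)
  have hrF : ∀ x : FixedPoints.subfield H F, σ ^ p ^ r • x = x :=
    htriv _ ((hmem _).mpr dvd_rfl)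
  obtain ⟨k, hk⟩ : ∃ k : ℕ, (σ : P ⧸ H) ^ k = a := by
    obtain ⟨k, -, hk⟩ := (mem_zpowers_iff_mem_range_orderOf.mp (hσq a)) |> mem_image.mp
    exact ⟨k, hk⟩
  have hcoset : ∀ {x y : P}, (x : P ⧸ H) = y → dep wF πF x = dep wF πF y := by
    intro x y hxy
    have := htriv _ (QuotientGroup.eq.mp hxy) πF
    rw [mul_smul, inv_smul_eq_iff] at this
    rw [dep, dep, this]
  have hkr : ¬ p ^ r ∣ k := fun h ↦ haH <| by
    rw [← QuotientGroup.eq_one_iff, ← hk, ← QuotientGroup.mk_pow, QuotientGroup.eq_one_iff, hmem]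
    exact h
  obtain ⟨v, q, hq, rfl⟩ := Nat.exists_eq_pow_mul_and_not_dvd
    (show k ≠ 0 by rintro rfl; exact hkr (dvd_zero _)) p hp.ne_one
  have hvr : v < r := not_le.mp fun h ↦ hkr ((pow_dvd_pow p h).mul_right q)
  obtain ⟨r, rfl⟩ : ∃ r', r = r' + 1 := ⟨r - 1, by omega⟩
  -- A power of `a` has the same break and generates the subgroup of order `p` of the quotient.
  set b := a ^ p ^ (r - v) with hb
  have hbσ : (b : P ⧸ H) = ((σ ^ (p ^ r * q) : P) : P ⧸ H) := by
    rw [hb, QuotientGroup.mk_pow, ← hk, ← pow_mul, QuotientGroup.mk_pow]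
    congr 1
    rw [mul_right_comm, ← pow_add, show v + (r - v) = r by omega]
  have hbH : b ∉ H := by
    rw [← QuotientGroup.eq_one_iff, hbσ, QuotientGroup.eq_one_iff, hmem, pow_succ]
    exact fun h ↦ hq (Nat.dvd_of_mul_dvd_mul_left (pow_pos hp.pos r) h)
  have hbt : dep w π b = w π ^ t :=
    le_antisymm ((T.dep_pow_le _ _).trans hat.le)
      (not_lt.mp fun h ↦ hbH (hH (T.mem_depLT.mpr h)))
  set J : ℕ → ℤ := fun n ↦ brk wF πF (σ ^ p ^ n) with hJ
  have hJ0 : ∑ h : H, truncBrk w π t (h : P) = Fintype.card H * J r := by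
    have hsum : ∑ h : H, truncBrk w π t (h : P) = ∑ h : H, truncBrk w π t (b * h) :=
      sum_congr rfl fun h _ ↦ (T.truncBrk_mul_eq hbt (h : P)).symm
    rw [hsum, ← T.card_mul_brk_fixed H hH hbH, hJ]
    congr 1
    exact brk_congr ((hcoset hbσ).trans (TF.dep_pow_mul_eq hp hrF r hq))
  have hJk : ∀ k ∈ range (p ^ (r + 1)), ∑ h : H, truncBrk w π t (σ ^ k * h) =
      Fintype.card H * if k = 0 then J r else J (padicValNat p k) := by
    intro k hk
    split_ifs with hk0
    · simpa [hk0] using hJ0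
    · have hkH : σ ^ k ∉ H := fun h ↦ by
        have := Nat.le_of_dvd (by omega) ((hmem k).mp h)
        rw [mem_range] at hk
        omega
      rw [← T.card_mul_brk_fixed H hH hkH, hJ]
      congr 1
      exact brk_congr (TF.dep_pow_eq_padicValNat hp hrF hk0)
  have hwpF : wF (p : FixedPoints.subfield H F) < 1 := by
    simpa [hwF] using hwp
  rw [sum_eq_sum_range_sum_subgroup H hσq, hr, sum_congr rfl hJk, ← mul_sum,
    Subgroup.card_eq_card_quotient_mul_card_subgroup H, hr, Nat.cast_mul, mul_comm,
    Nat.card_eq_fintype_card]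
  refine mul_dvd_mul_left _ ?_
  rw [Nat.cast_pow]
  refine pow_dvd_sum_breaks hp J r fun n hn hnr ↦ ?_
  refine TF.sen hp hwpF n hn hrF hσwild (hdepH _ ?_)
  rw [hmem, Nat.pow_dvd_pow_iff_le_right hp.one_lt]
  omega

end TotRam

end Trunc

/-! ### The tame quotient -/

section

variable {F Γ₀ G : Type*} [Field F] [LinearOrderedCommGroupWithZero Γ₀] {w : Valuation F Γ₀}
  {π : F}

lemma residue_eq_residue_iff {x y : w.valuationSubring} :
    IsLocalRing.residue w.valuationSubring x = IsLocalRing.residue w.valuationSubring y ↔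
      w (x - y : F) < 1 := by
  rw [← sub_eq_zero, ← map_sub, IsLocalRing.residue_eq_zero_iff,
    Valuation.mem_maximalIdeal_iff]
  rfl

namespace TotRam

section Group

variable [Group G] [MulSemiringAction G F] (T : TotRam w G π)

/-- The tame character `g ↦ g π / π` with values in the residue field. -/
noncomputable def tameHom : G →* (IsLocalRing.ResidueField w.valuationSubring)ˣ :=
  MonoidHom.toHomUnits
    { toFun g := IsLocalRing.residue w.valuationSubring ⟨g • π / π, (T.w_ratio g T.ne_zero).le⟩
      map_one' := by
        rw [← map_one (IsLocalRing.residue w.valuationSubring), residue_eq_residue_iff]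
        simp [T.ne_zero]
      map_mul' g h := by
        rw [← map_mul, residue_eq_residue_iff]
        have h0 := ne_zero_of_smul h T.ne_zero
        have h1 := T.ratio_sub_le g (x := h • π) (k := 1) (by rw [T.invariant, zpow_one])
        have h2 : (g * h) • π / π - g • π / π * (h • π / π) =
            (g • h • π / h • π - (g • π / π) ^ (1 : ℤ)) * (h • π / π) := by
          have hπ := T.ne_zero
          rw [mul_smul, zpow_one]; field_simp
        change w ((g * h) • π / π - g • π / π * (h • π / π)) < 1
        rw [h2, map_mul, T.w_ratio h T.ne_zero, mul_one]
        exact h1.trans_lt ((mul_le_of_le_one_right' (T.dep_le_one g)).trans_lt T.lt_one) }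

lemma coe_tameHom (g : G) : (T.tameHom g : IsLocalRing.ResidueField w.valuationSubring) =
    IsLocalRing.residue w.valuationSubring ⟨g • π / π, (T.w_ratio g T.ne_zero).le⟩ := rfl

lemma tameHom_pow_eq_one_iff (g : G) (n : ℕ) :
    T.tameHom g ^ n = 1 ↔ w ((g • π / π) ^ n - 1) < 1 := by
  rw [← Units.val_inj, Units.val_pow_eq_pow_val, coe_tameHom, Units.val_one,
    ← map_pow, ← map_one (IsLocalRing.residue w.valuationSubring), residue_eq_residue_iff]
  rfl

lemma mem_ker_tameHom {g : G} : g ∈ T.tameHom.ker ↔ dep w π g < 1 := by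
  rw [MonoidHom.mem_ker, ← pow_one (T.tameHom g), T.tameHom_pow_eq_one_iff, pow_one, dep]

include T in
/-- Raising a wild element to a power prime to the residue characteristic preserves its depth. -/
lemma dep_pow_eq_of_w_natCast_eq_one {g : G} (hg : dep w π g < 1) {l : ℕ} (hl : w (l : F) = 1) :
    dep w π (g ^ l) = dep w π g := by
  by_cases h0 : dep w π g = 0
  · exact le_antisymm (T.dep_pow_le g l) (h0 ▸ zero_le)
  set y := g • π - π with hy
  have hwy : w y = w π * dep w π g := T.w_smul_sub g
  have hy0 : 0 < w y := by
    rw [hwy]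
    exact zero_lt_iff.mpr (mul_ne_zero T.w_ne_zero h0)
  have h1 : g ^ l • π - π = l * y + ∑ j ∈ range l, (g ^ j • y - y) := by
    rw [sum_sub_distrib, sum_const, card_range, nsmul_eq_mul, add_sub_cancel]
    simp only [hy, smul_sub, smul_smul, ← pow_succ]
    rw [sum_range_sub (fun j ↦ g ^ j • π)]
    simp
  have h2 : w (g ^ l • π - π) = w y := by
    rw [h1, Valuation.map_add_eq_of_lt_left, map_mul, hl, one_mul]
    rw [map_mul, hl, one_mul]
    refine w.map_sum_lt hy0.ne' fun j _ ↦ (T.smul_sub_le_mul _ _).trans_lt ?_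
    exact mul_lt_of_lt_one_right hy0 ((T.dep_pow_le _ _).trans_lt hg)
  rw [T.w_smul_sub, hwy] at h2
  exact mul_left_cancel₀ T.w_ne_zero h2

variable [FaithfulSMul G F]

include T in
/-- The prime orders of wild elements are equal to the residue characteristic. -/
lemma w_natCast_lt_one_of_orderOf {g : G} (hg : dep w π g < 1) {l : ℕ} (hl : l.Prime)
    (hgl : orderOf g = l) : w (l : F) < 1 := by
  refine lt_of_le_of_ne (natCast_mem w.valuationSubring l) fun h ↦ ?_
  have h1 := T.dep_pow_eq_of_w_natCast_eq_one hg h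
  rw [← hgl, pow_orderOf_eq_one, dep_one T.ne_zero] at h1
  rw [T.eq_one_of_dep_eq_zero h1.symm, orderOf_one] at hgl
  exact hl.ne_one hgl.symm

lemma eq_of_w_natCast_lt_one (w : Valuation F Γ₀) {p q : ℕ} (hp : p.Prime) (hq : q.Prime)
    (hwp : w (p : F) < 1) (hwq : w (q : F) < 1) : q = p := by
  by_contra hne
  obtain ⟨u, v, huv⟩ := Nat.isCoprime_iff_coprime.mpr ((Nat.coprime_primes hq hp).mpr hne)
  have h1 : (u : F) * q + v * p = 1 := by exact_mod_cast congrArg (Int.cast : ℤ → F) huv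
  have h2 : w (1 : F) < 1 := by
    rw [← h1]
    refine w.map_add_lt ?_ ?_
    · rw [map_mul]
      exact mul_lt_one_of_nonneg_of_lt_one_right (intCast_mem w.valuationSubring u) zero_le hwq
    · rw [map_mul]
      exact mul_lt_one_of_nonneg_of_lt_one_right (intCast_mem w.valuationSubring v) zero_le hwp
  rw [map_one] at h2
  exact lt_irrefl _ h2

/-- A nontrivial wild subgroup is a `p`-group, where `p` is the residue characteristic, and the
tame quotient has order prime to `p`. -/
lemma exists_prime [Finite G] (h : ∃ g : G, g ≠ 1 ∧ dep w π g < 1) :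
    ∃ p : ℕ, p.Prime ∧ w (p : F) < 1 ∧ IsPGroup p T.tameHom.ker ∧
      ¬ p ∣ Nat.card (G ⧸ T.tameHom.ker) := by
  obtain ⟨g, hg1, hg⟩ := h
  have key : ∀ l : ℕ, l.Prime → l ∣ Nat.card T.tameHom.ker → w (l : F) < 1 := by
    intro l hl hdvd
    have : Fact l.Prime := ⟨hl⟩
    obtain ⟨x, hx⟩ := exists_prime_orderOf_dvd_card' l hdvd
    exact T.w_natCast_lt_one_of_orderOf (T.mem_ker_tameHom.mp x.2) hl
      (by rw [Subgroup.orderOf_coe, hx])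
  have hcard : Nat.card T.tameHom.ker ≠ 1 := by
    intro h1
    have := (Nat.card_eq_one_iff_unique.mp h1).1
    exact hg1 (congrArg Subtype.val
      (Subsingleton.elim (⟨g, T.mem_ker_tameHom.mpr hg⟩ : T.tameHom.ker) 1))
  obtain ⟨p, hp, hpd⟩ := Nat.exists_prime_and_dvd hcard
  have hwp := key p hp hpd
  refine ⟨p, hp, hwp, IsPGroup.of_card (Nat.eq_prime_pow_of_unique_prime_dvd Nat.card_pos.ne'
    fun {d} hd hdd ↦ eq_of_w_natCast_lt_one w hp hd hwp (key d hd hdd)), fun hdvd ↦ ?_⟩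
  have : Fact p.Prime := ⟨hp⟩
  have hp0 : (p : IsLocalRing.ResidueField w.valuationSubring) = 0 := by
    rw [← map_natCast (IsLocalRing.residue w.valuationSubring),
      ← map_zero (IsLocalRing.residue w.valuationSubring), residue_eq_residue_iff]
    simpa using hwp
  have : CharP (IsLocalRing.ResidueField w.valuationSubring) p :=
    (CharP.charP_iff_prime_eq_zero hp).mpr hp0
  obtain ⟨x, hx⟩ := exists_prime_orderOf_dvd_card' p hdvd
  obtain ⟨x, rfl⟩ := QuotientGroup.mk_surjective x
  have h1 : x ^ p ∈ T.tameHom.ker := by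
    rw [← QuotientGroup.eq_one_iff, QuotientGroup.mk_pow, ← hx, pow_orderOf_eq_one]
  rw [MonoidHom.mem_ker, map_pow, ← Units.val_inj, Units.val_pow_eq_pow_val, Units.val_one,
    ← sub_eq_zero] at h1
  have h2 : ((T.tameHom x : IsLocalRing.ResidueField w.valuationSubring) - 1) ^ p = 0 := by
    rw [sub_pow_char, one_pow, h1]
  have h3 : x ∈ T.tameHom.ker := by
    rw [MonoidHom.mem_ker, ← Units.val_inj, Units.val_one, ← sub_eq_zero]
    exact pow_eq_zero_iff hp.ne_zero |>.mp h2
  rw [(QuotientGroup.eq_one_iff x).mpr h3, orderOf_one] at hx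
  exact hp.ne_one hx.symm

end Group

section CommGroup

variable [CommGroup G] [MulSemiringAction G F] (T : TotRam w G π)

/-- In a commutative group the tame character has order dividing every nonnegative break `n`,
because `s` and `g` move `π` in the same way in both orders. -/
lemma tameHom_pow_brk {g : G} {n : ℕ} (hg : dep w π g = w π ^ n) (s : G) :
    T.tameHom s ^ n = 1 := by
  rw [tameHom_pow_eq_one_iff]
  set u := s • π / π with hu
  set α := g • π / π - 1 with hα
  have hwu : w u = 1 := T.w_ratio s T.ne_zero
  have hu0 : u ≠ 0 := by rintro h; simp [h] at hwu
  have hwα : w α = w π ^ (n : ℤ) := by rw [zpow_natCast]; exact hg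
  have hα0 : w α ≠ 0 := by rw [hwα]; exact zpow_ne_zero _ T.w_ne_zero
  have hαne : α ≠ 0 := (Valuation.ne_zero_iff w).mp hα0
  have hsπ : s • π = u * π := by rw [hu, div_mul_cancel₀ _ T.ne_zero]
  have hgπ : g • π = (1 + α) * π := by rw [hα]; field_simp [T.ne_zero]; ring
  have hcomm : u * (s • α - α) = (g • u - u) * (1 + α) := by
    have h1 : s • g • π = g • s • π := smul_comm s g π
    rw [hsπ, hgπ, smul_mul', smul_mul', hsπ, hgπ, smul_add, smul_one,
      ← mul_assoc, ← mul_assoc] at h1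
    have h2 := mul_right_cancel₀ T.ne_zero h1
    linear_combination h2
  have hw1 : w (s • α - α) ≤ w π * w α := by
    have h1 := congrArg w hcomm
    have h2 : w (1 + α) = 1 := by
      rw [hα, add_sub_cancel]; exact T.w_ratio g T.ne_zero
    rw [map_mul, map_mul, hwu, one_mul, h2, mul_one] at h1
    rw [h1]
    exact T.smul_sub_le_of_unit g hwu
  have hw2 : w (s • α / α - 1) ≤ w π := by
    rw [show s • α / α - 1 = (s • α - α) / α by field_simp, map_div₀]
    exact div_le_of_le_mul₀ zero_le zero_le hw1
  have hw3 : w (s • α / α - u ^ n) ≤ w π := by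
    have := T.ratio_sub_le s hwα
    rw [zpow_natCast] at this
    exact this.trans (mul_le_of_le_one_right' (T.dep_le_one s))
  rw [show u ^ n - 1 = (s • α / α - 1) - (s • α / α - u ^ n) by ring]
  exact ((w.map_sub _ _).trans (max_le hw2 hw3)).trans_lt T.lt_one

lemma card_tame_dvd [Finite G] {g : G} {n : ℤ} (hn : 0 ≤ n) (hg : dep w π g = w π ^ n) :
    (Nat.card (G ⧸ T.tameHom.ker) : ℤ) ∣ n := by
  obtain ⟨n, rfl⟩ := Int.eq_ofNat_of_zero_le hn
  have hcyc : IsCyclic (G ⧸ T.tameHom.ker) := isCyclic_of_injective_ringHom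
    ((Units.coeHom _).comp (QuotientGroup.kerLift T.tameHom))
    (Units.val_injective.comp (QuotientGroup.kerLift_injective T.tameHom))
  obtain ⟨x, hx⟩ := hcyc.exists_generator
  rw [Int.natCast_dvd_natCast, ← orderOf_eq_card_of_forall_mem_zpowers hx]
  obtain ⟨s, rfl⟩ := QuotientGroup.mk_surjective x
  rw [orderOf_dvd_iff_pow_eq_one, ← QuotientGroup.mk_pow, QuotientGroup.eq_one_iff,
    MonoidHom.mem_ker, map_pow]
  rw [zpow_natCast] at hg
  exact T.tameHom_pow_brk hg s

include T in
/-- For a faithful totally ramified action of a finite commutative group `G`, the sum over `G` of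
the breaks truncated at a positive break `t` is divisible by `|G|`. The wild part is handled by the
`p`-group case and the tame part, of order prime to `p`, divides every single break. -/
theorem card_dvd_sum_truncBrk [Fintype G] [FaithfulSMul G F] {t : ℤ} (ht : 1 ≤ t) {a : G}
    (hat : dep w π a = w π ^ t) : (Nat.card G : ℤ) ∣ ∑ g : G, truncBrk w π t g := by
  classical
  have ha1 : dep w π a < 1 := by
    rw [hat, ← zpow_zero (w π), T.zpow_lt_zpow_iff]; omega
  have ha : a ≠ 1 := by
    rintro rfl
    rw [dep_one T.ne_zero] at hat
    exact zpow_ne_zero _ T.w_ne_zero hat.symm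
  obtain ⟨p, hp, hwp, hpG, hpt⟩ := T.exists_prime ⟨a, ha, ha1⟩
  have hsum : ∑ g : G, truncBrk w π t g = ∑ g : T.tameHom.ker, truncBrk w π t (g : G) := by
    rw [← sum_subtype (univ.filter (· ∈ T.tameHom.ker)) (by simp) (truncBrk w π t)]
    refine (sum_subset (subset_univ _) fun g _ hg ↦ ?_).symm
    have hg1 : dep w π g = 1 := by
      refine le_antisymm (T.dep_le_one g) (not_lt.mp fun h ↦ hg ?_)
      simpa using T.mem_ker_tameHom.mpr h
    rw [truncBrk, if_neg, T.brk_eq (k := 0) (by rw [hg1, zpow_zero])]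
    rw [hg1, ← zpow_zero (w π), T.zpow_lt_zpow_iff]
    omega
  have htame : (Nat.card (G ⧸ T.tameHom.ker) : ℤ) ∣
      ∑ g : T.tameHom.ker, truncBrk w π t (g : G) := by
    refine dvd_sum fun g _ ↦ ?_
    rw [truncBrk]
    split_ifs with h
    · exact T.card_tame_dvd (by omega) hat
    · have h1 := T.dep_eq ((zpow_pos T.pos t).trans_le (not_lt.mp h)).ne'
      refine T.card_tame_dvd ?_ h1
      have := T.dep_le_one (g : G)
      rwa [h1, ← zpow_zero (w π), T.zpow_le_zpow_iff] at this
  have hwild : (Nat.card T.tameHom.ker : ℤ) ∣ ∑ g : T.tameHom.ker, truncBrk w π t (g : G) :=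
    (T.restrict T.tameHom.ker).card_dvd_sum_truncBrk_of_isPGroup hp hwp hpG
      (fun g ↦ T.mem_ker_tameHom.mp g.2) (a := ⟨a, T.mem_ker_tameHom.mpr ha1⟩) hat
  rw [hsum, Subgroup.card_eq_card_quotient_mul_card_subgroup T.tameHom.ker, Nat.cast_mul]
  refine IsCoprime.mul_dvd ?_ htame hwild
  have : Fact p.Prime := ⟨hp⟩
  obtain ⟨n, hn⟩ := (IsPGroup.iff_card (p := p)).mp hpG
  rw [Nat.isCoprime_iff_coprime, hn]
  exact Nat.Coprime.pow_right n ((Nat.Prime.coprime_iff_not_dvd hp).mpr hpt).symm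

end CommGroup

end TotRam

end

/-! ### Uniqueness of the extension of a complete valuation -/

section Complete

variable {K L : Type*} [Field K] [Field L] [Algebra K L]

lemma toNNReal_exp_one {e : ℝ≥0} (he : e ≠ 0) :
    WithZeroMulInt.toNNReal he (WithZero.exp (1 : ℤ)) = e := by
  rw [WithZeroMulInt.toNNReal_neg_apply he WithZero.exp_ne_zero]
  simp [WithZero.exp]

/-- The absolute value `2 ^ (-ord)` attached to an integer-valued valuation. -/
noncomputable def absOfValuation (w : Valuation L ℤᵐ⁰) : AbsoluteValue L ℝ where
  toFun x := WithZeroMulInt.toNNReal (e := 2) two_ne_zero (w x)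
  map_mul' x y := by simp
  nonneg' x := NNReal.coe_nonneg _
  eq_zero' x := by
    rw [NNReal.coe_eq_zero, map_eq_zero, map_eq_zero]
  add_le' x y := by
    have hm := (WithZeroMulInt.toNNReal_strictMono (e := 2) one_lt_two).monotone
    have := hm (w.map_add x y)
    rw [hm.map_max] at this
    exact_mod_cast this.trans (max_le_add_of_nonneg zero_le zero_le)

lemma absOfValuation_inj {w : Valuation L ℤᵐ⁰} {x y : L}
    (h : absOfValuation w x = absOfValuation w y) : w x = w y :=
  (WithZeroMulInt.toNNReal_strictMono (e := 2) one_lt_two).injective (NNReal.coe_injective h)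

/-- The valuation of a finite extension of a complete discretely valued field is invariant under
automorphisms. It is identified with a spectral norm. -/
theorem valuation_algEquiv [Valued K ℤᵐ⁰] [CompleteSpace K]
    (hv : Function.Surjective (Valued.v : Valuation K ℤᵐ⁰)) (w : Valuation L ℤᵐ⁰)
    [(Valued.v : Valuation K ℤᵐ⁰).HasExtension w] [FiniteDimensional K L] (σ : Gal(L/K)) (x : L) :
    w (σ x) = w x := by
  set v : Valuation K ℤᵐ⁰ := Valued.v with hvdef
  obtain ⟨x₀, hx₀⟩ := hv (WithZero.exp 1)
  -- The base of the norm on `K` is chosen so that the absolute value of `w` extends it.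
  set e : ℝ≥0 := WithZeroMulInt.toNNReal (e := 2) two_ne_zero (w (algebraMap K L x₀)) with he
  have he1 : 1 < e := by
    rw [he, ← map_one (WithZeroMulInt.toNNReal (e := 2) two_ne_zero)]
    refine WithZeroMulInt.toNNReal_strictMono one_lt_two ?_
    have h1 := Valuation.HasExtension.val_map_lt_iff v w 1 x₀
    rw [map_one, map_one, map_one, hx₀] at h1
    refine h1.mpr ?_
    rw [← WithZero.exp_zero, WithZero.exp_lt_exp]
    exact Int.zero_lt_one
  have he0 : e ≠ 0 := (zero_lt_one.trans he1).ne'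
  have hval : ∀ y : K, WithZeroMulInt.toNNReal he0 (v y) =
      WithZeroMulInt.toNNReal (e := 2) two_ne_zero (w (algebraMap K L y)) := by
    intro y
    by_cases hy : y = 0
    · simp [hy]
    · obtain ⟨n, h1⟩ : ∃ n : ℤ, v y = v (x₀ ^ n) := by
        refine ⟨WithZero.log (v y), ?_⟩
        rw [map_zpow₀, hx₀, ← WithZero.exp_zsmul, smul_eq_mul, mul_one,
          WithZero.exp_log ((Valuation.ne_zero_iff v).mpr hy)]
      rw [(Valuation.HasExtension.val_map_eq_iff v w _ _).mpr h1, h1, map_zpow₀, map_zpow₀,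
        map_zpow₀, map_zpow₀, map_zpow₀, hx₀, toNNReal_exp_one]
  let : v.RankOne :=
    { hom' := (WithZeroMulInt.toNNReal he0).comp MonoidWithZeroHom.ValueGroup₀.embedding
      strictMono' := (WithZeroMulInt.toNNReal_strictMono he1).comp
        MonoidWithZeroHom.ValueGroup₀.embedding_strictMono
      exists_val_nontrivial := ⟨x₀, by rw [hx₀]; simp, by
        rw [hx₀, ← WithZero.exp_zero, Ne, WithZero.exp_inj]; omega⟩ }
  let : NontriviallyNormedField K := Valued.toNontriviallyNormedField K ℤᵐ⁰
  have hnorm : ∀ y : K, absOfValuation w (algebraMap K L y) = ‖y‖ := by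
    intro y
    change ((WithZeroMulInt.toNNReal (e := 2) two_ne_zero (w (algebraMap K L y)) : ℝ≥0) : ℝ) =
      ((WithZeroMulInt.toNNReal he0 (MonoidWithZeroHom.ValueGroup₀.embedding (v.restrict y)) :
        ℝ≥0) : ℝ)
    rw [v.embedding_restrict, hval]
  apply absOfValuation_inj
  rw [spectralNorm_unique_field_norm_ext hnorm, spectralNorm_unique_field_norm_ext hnorm,
    ← spectralNorm_eq_of_equiv]

end Complete

/-! ### The inertia group of a complete extension acts totally ramified -/

section Inertia

variable {K L : Type*} [Field K] [Field L] [Algebra K L] {v : Valuation K ℤᵐ⁰} {w : Valuation L ℤᵐ⁰}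
  [v.HasExtension w]

lemma mem_integralClosure_iff [FiniteDimensional K L] [IsGalois K L]
    (hinv : ∀ (σ : Gal(L/K)) (x : L), w (σ x) = w x) {b : L} :
    b ∈ integralClosure v.valuationSubring L ↔ w b ≤ 1 := by
  constructor
  · intro hb
    exact (Valuation.valuationSubring.integers w).mem_of_integral (x := b)
      (IsIntegral.tower_top (A := w.valuationSubring) (R := v.valuationSubring) hb)
  · intro hb
    have hlift : MulSemiringAction.charpoly Gal(L/K) b ∈
        Polynomial.lifts (algebraMap v.valuationSubring L) := by
      rw [Polynomial.lifts_iff_coeff_lifts]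
      intro n
      obtain ⟨c, hc⟩ := (IsGalois.mem_range_algebraMap_iff_fixed (F := K)
        ((MulSemiringAction.charpoly Gal(L/K) b).coeff n)).mpr
        fun σ ↦ MulSemiringAction.smul_coeff_charpoly b n σ
      have hc1 : v c ≤ 1 := by
        rw [← Valuation.HasExtension.val_map_le_one_iff v w, hc]
        exact w_coeff_prod_X_sub_C_le_one w _ _ (fun σ _ ↦ (hinv σ b).trans_le hb) n
      exact ⟨⟨c, hc1⟩, hc⟩
    obtain ⟨q, hq, -, hqm⟩ := Polynomial.lifts_and_natDegree_eq_and_monic hlift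
      (MulSemiringAction.monic_charpoly _ b)
    refine ⟨q, hqm, ?_⟩
    rw [← Polynomial.eval_map, hq, MulSemiringAction.eval_charpoly]

lemma mem_lowerGroup_iff [FiniteDimensional K L] [IsGalois K L]
    (hinv : ∀ (σ : Gal(L/K)) (x : L), w (σ x) = w x) {i : ℤ} {σ : Gal(L/K)} :
    σ ∈ lowerGroup v w i ↔ ∀ b, w b ≤ 1 → w (σ b - b) ≤ WithZero.exp (-(i + 1)) := by
  simp only [← mem_integralClosure_iff (v := v) hinv]
  rfl

/-- The residues of the integral elements fixed by a group of automorphisms, as an intermediate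
field of the residue extension. -/
def fixedResidue (v : Valuation K ℤᵐ⁰) (w : Valuation L ℤᵐ⁰) [v.HasExtension w]
    (H : Subgroup Gal(L/K)) :
    IntermediateField (IsLocalRing.ResidueField v.valuationSubring)
      (IsLocalRing.ResidueField w.valuationSubring) where
  carrier := {a | ∃ c : w.valuationSubring, (∀ σ ∈ H, σ (c : L) = c) ∧ IsLocalRing.residue _ c = a}
  mul_mem' := by
    rintro _ _ ⟨c, hc, rfl⟩ ⟨d, hd, rfl⟩
    exact ⟨c * d, fun σ hσ ↦ by simp [hc σ hσ, hd σ hσ], map_mul _ _ _⟩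
  add_mem' := by
    rintro _ _ ⟨c, hc, rfl⟩ ⟨d, hd, rfl⟩
    exact ⟨c + d, fun σ hσ ↦ by simp [hc σ hσ, hd σ hσ], map_add _ _ _⟩
  algebraMap_mem' := by
    intro a
    obtain ⟨c, rfl⟩ := IsLocalRing.residue_surjective a
    exact ⟨algebraMap _ _ c, fun σ _ ↦ by simp, rfl⟩
  inv_mem' := by
    rintro _ ⟨c, hc, rfl⟩
    by_cases hcu : IsUnit c
    · obtain ⟨u, rfl⟩ := hcu
      have h1 : ((u⁻¹ : w.valuationSubringˣ) : w.valuationSubring) * (u : w.valuationSubring) =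
        1 := u.inv_mul
      refine ⟨↑u⁻¹, fun σ hσ ↦ ?_, ?_⟩
      · have h2 : (((u⁻¹ : w.valuationSubringˣ) : w.valuationSubring) : L) = (u : L)⁻¹ :=
          eq_inv_of_mul_eq_one_left (congrArg Subtype.val h1)
        rw [h2, map_inv₀, hc σ hσ]
      · exact eq_inv_of_mul_eq_one_left (by rw [← map_mul, h1, map_one])
    · refine ⟨0, by simp, ?_⟩
      rw [(IsLocalRing.residue_eq_zero_iff c).mpr ((IsLocalRing.mem_maximalIdeal c).mpr hcu)]
      simp

/-- If `H` consists of inertia elements and the residue extension is separable, then the integral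
elements fixed by `H` exhaust the residue field. The characteristic polynomial of an integral
element over the fixed field of `H` reduces to a power of a linear polynomial, so residue classes
are purely inseparable over the residues of fixed elements. -/
lemma exists_fixed_sub_lt_one [FiniteDimensional K L]
    [Algebra.IsSeparable (IsLocalRing.ResidueField v.valuationSubring)
      (IsLocalRing.ResidueField w.valuationSubring)]
    (H : Subgroup Gal(L/K)) (hH : ∀ σ ∈ H, ∀ b, w b ≤ 1 → w (σ b - b) < 1)
    (hinv : ∀ (σ : Gal(L/K)) (x : L), w (σ x) = w x) {x : L} (hx : w x ≤ 1) :
    ∃ c : L, (∀ σ : H, σ • c = c) ∧ w (x - c) < 1 := by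
  classical
  cases nonempty_fintype H
  set k := IsLocalRing.ResidueField v.valuationSubring
  set l := IsLocalRing.ResidueField w.valuationSubring
  set t : IntermediateField k l := fixedResidue v w H
  have : Algebra.IsSeparable t l := Algebra.isSeparable_tower_top_of_isSeparable k t l
  set a : l := IsLocalRing.residue _ ⟨x, hx⟩ with ha
  have hσx : ∀ σ : H, w (σ • x) ≤ 1 := fun σ ↦ (hinv σ x).trans_le hx
  set f : Polynomial w.valuationSubring :=
    ∏ σ : H, (Polynomial.X - Polynomial.C (⟨σ • x, hσx σ⟩ : w.valuationSubring)) with hf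
  have hfc : f.map (algebraMap w.valuationSubring L) = MulSemiringAction.charpoly H x := by
    simp [hf, Polynomial.map_prod, MulSemiringAction.charpoly]
  have hfa : f.map (IsLocalRing.residue w.valuationSubring) =
      (Polynomial.X - Polynomial.C a) ^ Fintype.card H := by
    rw [hf, Polynomial.map_prod, ← card_univ, ← prod_const]
    refine prod_congr rfl fun σ _ ↦ ?_
    rw [Polynomial.map_sub, Polynomial.map_X, Polynomial.map_C, ha]
    congr 2
    exact residue_eq_residue_iff.mpr (hH σ σ.2 x hx)
  have hlift : (Polynomial.X - Polynomial.C a) ^ Fintype.card H ∈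
      Polynomial.lifts (algebraMap t l) := by
    rw [Polynomial.lifts_iff_coeff_lifts]
    intro n
    refine ⟨⟨(((Polynomial.X - Polynomial.C a) ^ Fintype.card H).coeff n), f.coeff n,
      fun σ hσ ↦ ?_, ?_⟩, rfl⟩
    · have h1 : ((f.coeff n : w.valuationSubring) : L) =
          (MulSemiringAction.charpoly H x).coeff n := by
        rw [← hfc, Polynomial.coeff_map]; rfl
      rw [h1]
      exact MulSemiringAction.smul_coeff_charpoly x n (⟨σ, hσ⟩ : H)
    · rw [← hfa, Polynomial.coeff_map]
  obtain ⟨q, hq⟩ := hlift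
  have hint : IsIntegral t a := (Algebra.IsSeparable.isSeparable t a).isIntegral
  have hroot : Polynomial.aeval a q = 0 := by
    rw [← Polynomial.eval_map_algebraMap]
    rw [Polynomial.coe_mapRingHom] at hq
    rw [hq]
    simp [Fintype.card_ne_zero]
  have hdvd := Polynomial.map_dvd (algebraMap t l) (minpoly.dvd t a hroot)
  rw [Polynomial.coe_mapRingHom] at hq
  rw [hq, dvd_prime_pow (Polynomial.prime_X_sub_C a)] at hdvd
  obtain ⟨i, -, hi⟩ := hdvd
  have hi' := Polynomial.eq_of_monic_of_associated ((minpoly.monic hint).map _)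
    ((Polynomial.monic_X_sub_C a).pow i) hi
  have hdeg : (minpoly t a).natDegree = i := by
    rw [← Polynomial.natDegree_map (algebraMap t l), hi', Polynomial.natDegree_pow,
      Polynomial.natDegree_X_sub_C, mul_one]
  have hsep : (((Polynomial.X - Polynomial.C a) ^ i : Polynomial l)).Separable := by
    rw [← hi']
    exact Polynomial.Separable.map (Algebra.IsSeparable.isSeparable t a)
  have hi1 := (Polynomial.Separable.of_pow (Polynomial.not_isUnit_X_sub_C a)
    (by rw [← hdeg]; exact (minpoly.natDegree_pos hint).ne') hsep).2
  obtain ⟨⟨_, c, hc, rfl⟩, hac⟩ := minpoly.natDegree_eq_one_iff.mp (hdeg.trans hi1)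
  exact ⟨c, fun σ ↦ hc σ σ.2, residue_eq_residue_iff.mp (ha.symm.trans hac.symm)⟩

variable [FiniteDimensional K L] [IsGalois K L]
  [Algebra.IsSeparable (IsLocalRing.ResidueField v.valuationSubring)
      (IsLocalRing.ResidueField w.valuationSubring)]

lemma totRam_inertia (hinv : ∀ (σ : Gal(L/K)) (x : L), w (σ x) = w x) {π : L}
    (hπ : w π = WithZero.exp (-1 : ℤ)) : TotRam w (lowerGroup v w 0) π where
  lt_one := by
    rw [hπ, ← WithZero.exp_zero, WithZero.exp_lt_exp]; exact neg_one_lt_zero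
  ne_zero := by
    rintro rfl
    rw [map_zero] at hπ
    exact WithZero.exp_ne_zero hπ.symm
  exists_zpow x hx := by
    refine ⟨-WithZero.log (w x), ?_⟩
    rw [hπ, ← WithZero.exp_zsmul, smul_eq_mul, mul_neg_one, neg_neg,
      WithZero.exp_log ((Valuation.ne_zero_iff w).mpr hx)]
  invariant g x := hinv g x
  residue x hx := by
    refine exists_fixed_sub_lt_one (v := v) _ (fun σ hσ b hb ↦ ?_) hinv hx
    refine ((mem_lowerGroup_iff hinv).mp hσ b hb).trans_lt ?_
    rw [← WithZero.exp_zero, WithZero.exp_lt_exp]; exact neg_one_lt_zero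

/-- The higher ramification groups are the depth filtration of the inertia group. -/
lemma mem_lowerGroup_iff_dep (hinv : ∀ (σ : Gal(L/K)) (x : L), w (σ x) = w x) {π : L}
    (hπ : w π = WithZero.exp (-1 : ℤ)) {i : ℤ} (g : lowerGroup v w 0) :
    (g : Gal(L/K)) ∈ lowerGroup v w i ↔ dep w π g ≤ w π ^ i := by
  have T := totRam_inertia (v := v) hinv hπ
  have hexp : WithZero.exp (-(i + 1)) = w π * w π ^ i := by
    rw [hπ, ← WithZero.exp_zsmul, ← WithZero.exp_add, smul_eq_mul]
    congr 1; ring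
  rw [mem_lowerGroup_iff hinv, hexp]
  constructor
  · intro h
    have h1 := h π T.lt_one.le
    exact (mul_le_mul_iff_right₀ T.pos).mp ((T.w_smul_sub g).symm.trans_le h1)
  · intro h b hb
    exact (T.smul_sub_le g hb).trans ((T.w_smul_sub g).trans_le (mul_le_mul_right h _))

end Inertia

/-! ### The Herbrand function -/

lemma card_mul_relIndex {G : Type*} [Group G] {H K : Subgroup G} (h : H ≤ K) :
    Nat.card H * H.relIndex K = Nat.card K := by
  simpa using Subgroup.relIndex_mul_relIndex ⊥ H K bot_le h

section Herbrand

variable {K L : Type*} [Field K] [Field L] [Algebra K L] (v : Valuation K ℤᵐ⁰)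
  (w : Valuation L ℤᵐ⁰)

lemma lowerGroup_antitone : Antitone (lowerGroup v w) := by
  intro i j hij σ hσ b hb
  refine (hσ b hb).trans ?_
  rw [WithZero.exp_le_exp]
  omega

lemma lowerGroupReal_intCast (m : ℤ) : lowerGroupReal v w m = lowerGroup v w m := by
  rw [lowerGroupReal, Int.ceil_intCast]

lemma lowerGroupReal_zero : lowerGroupReal v w 0 = lowerGroup v w 0 := by
  rw [lowerGroupReal, Int.ceil_zero]

lemma lowerGroupReal_antitone : Antitone (lowerGroupReal v w) := fun _ _ h ↦
  lowerGroup_antitone v w (Int.ceil_mono h)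

lemma herbrandPhi_zero : herbrandPhi v w 0 = 0 := intervalIntegral.integral_same

variable [FiniteDimensional K L]

/-- The integrand of the Herbrand function, as a ratio of orders, on both sides of `0`. -/
lemma one_div_lowerIndex (t : ℝ) : 1 / lowerIndex v w t =
    (Nat.card (lowerGroupReal v w t) : ℝ) / Nat.card (lowerGroup v w 0) := by
  have h0 : (Nat.card (lowerGroup v w 0) : ℝ) ≠ 0 := by exact_mod_cast Nat.card_pos.ne'
  have ht : (Nat.card (lowerGroupReal v w t) : ℝ) ≠ 0 := by exact_mod_cast Nat.card_pos.ne'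
  rw [lowerIndex, lowerGroupReal_zero]
  split_ifs with h
  · have h1 := card_mul_relIndex
      (lowerGroupReal_zero v w ▸ lowerGroupReal_antitone v w h)
    rw [← h1, Nat.cast_mul, div_mul_eq_div_div, div_self ht]
  · have h1 := card_mul_relIndex
      (lowerGroupReal_zero v w ▸ lowerGroupReal_antitone v w (not_le.mp h).le)
    rw [← h1, Nat.cast_mul, mul_div_cancel_left₀ _ h0, one_div, inv_inv]

lemma one_div_lowerIndex_pos (t : ℝ) : 0 < 1 / lowerIndex v w t := by
  rw [one_div_lowerIndex]
  have h0 : 0 < Nat.card (lowerGroup v w 0) := Nat.card_pos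
  have ht : 0 < Nat.card (lowerGroupReal v w t) := Nat.card_pos
  positivity

lemma intervalIntegrable_one_div_lowerIndex (a b : ℝ) :
    IntervalIntegrable (fun t ↦ 1 / lowerIndex v w t) MeasureTheory.volume a b := by
  refine Antitone.intervalIntegrable fun s t hst ↦ ?_
  rw [one_div_lowerIndex, one_div_lowerIndex]
  gcongr
  exact Nat.card_le_card_of_injective _
    (Subgroup.inclusion_injective (lowerGroupReal_antitone v w hst))

lemma herbrandPhi_sub (a b : ℝ) :
    herbrandPhi v w b - herbrandPhi v w a = ∫ t in a..b, 1 / lowerIndex v w t := by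
  rw [herbrandPhi, herbrandPhi]
  exact intervalIntegral.integral_interval_sub_left
    (intervalIntegrable_one_div_lowerIndex v w _ _) (intervalIntegrable_one_div_lowerIndex v w _ _)

lemma herbrandPhi_strictMono : StrictMono (herbrandPhi v w) := by
  intro a b hab
  rw [← sub_pos, herbrandPhi_sub]
  exact intervalIntegral.intervalIntegral_pos_of_pos
    (intervalIntegrable_one_div_lowerIndex v w _ _) (one_div_lowerIndex_pos v w) hab

/-- The Herbrand function is affine between consecutive integers. -/
lemma herbrandPhi_add_one_sub (m : ℤ) : herbrandPhi v w (m + 1) - herbrandPhi v w m =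
    (Nat.card (lowerGroup v w (m + 1)) : ℝ) / Nat.card (lowerGroup v w 0) := by
  rw [herbrandPhi_sub, intervalIntegral.integral_congr_ae
    (g := fun _ ↦ (Nat.card (lowerGroup v w (m + 1)) : ℝ) / Nat.card (lowerGroup v w 0))]
  · simp
  · refine Filter.Eventually.of_forall fun t ht ↦ ?_
    rw [Set.uIoc_of_le (by linarith)] at ht
    have hceil : ⌈t⌉ = m + 1 :=
      Int.ceil_eq_iff.mpr ⟨by push_cast; linarith [ht.1], by push_cast; exact ht.2⟩
    rw [one_div_lowerIndex, lowerGroupReal, hceil]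

lemma herbrandPhi_neg_one : herbrandPhi v w (-1) = -1 := by
  have h := herbrandPhi_add_one_sub v w (-1)
  have h0 : (Nat.card (lowerGroup v w 0) : ℝ) ≠ 0 := by exact_mod_cast Nat.card_pos.ne'
  rw [neg_add_cancel, div_self h0] at h
  push_cast at h
  rw [neg_add_cancel, herbrandPhi_zero] at h
  linarith

lemma herbrandPhi_natCast (n : ℕ) : herbrandPhi v w n =
    (∑ i ∈ range n, (Nat.card (lowerGroup v w (i + 1)) : ℝ)) / Nat.card (lowerGroup v w 0) := by
  induction n with
  | zero => simp [herbrandPhi_zero]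
  | succ n ih =>
    have h := herbrandPhi_add_one_sub v w n
    rw [sum_range_succ, add_div, ← ih, ← h]
    push_cast
    ring

lemma div_card_le_herbrandPhi {u : ℝ} (hu : 0 ≤ u) :
    u / Nat.card (lowerGroup v w 0) ≤ herbrandPhi v w u := by
  have h := intervalIntegral.integral_mono_on hu
    (f := fun _ ↦ (1 : ℝ) / Nat.card (lowerGroup v w 0)) (g := fun t ↦ 1 / lowerIndex v w t)
    (by simp) (intervalIntegrable_one_div_lowerIndex v w _ _) fun t _ ↦ by
      rw [one_div_lowerIndex]
      gcongr
      exact_mod_cast Nat.card_pos (α := lowerGroupReal v w t)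
  rw [intervalIntegral.integral_const, sub_zero, smul_eq_mul, mul_one_div] at h
  exact h

/-- The Herbrand function maps `[-1, ∞)` onto itself. -/
lemma herbrandPhi_surjOn :
    Set.SurjOn (herbrandPhi v w) (Set.Ici (-1)) (Set.Ici (-1)) := by
  intro s hs
  rw [Set.mem_Ici] at hs
  have hc : Continuous (herbrandPhi v w) :=
    intervalIntegral.continuous_primitive (intervalIntegrable_one_div_lowerIndex v w) 0
  have h0 : (0 : ℝ) < Nat.card (lowerGroup v w 0) := by exact_mod_cast Nat.card_pos
  set b := max 0 (s * Nat.card (lowerGroup v w 0)) with hb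
  have hb0 : 0 ≤ b := le_max_left _ _
  have hsb : s ≤ herbrandPhi v w b := by
    refine le_trans ?_ (div_card_le_herbrandPhi v w hb0)
    rw [le_div_iff₀ h0]
    exact le_max_right _ _
  obtain ⟨y, hy, hys⟩ := intermediate_value_Icc (show (-1 : ℝ) ≤ b by linarith) hc.continuousOn
    ⟨(herbrandPhi_neg_one v w).trans_le hs, hsb⟩
  exact ⟨y, hy.1, hys⟩

lemma herbrandPsi_mem {s : ℝ} (hs : -1 ≤ s) :
    -1 ≤ herbrandPsi v w s ∧ herbrandPhi v w (herbrandPsi v w s) = s :=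
  ⟨(herbrandPhi_surjOn v w).mapsTo_invFunOn hs, (herbrandPhi_surjOn v w).rightInvOn_invFunOn hs⟩

lemma herbrandPsi_herbrandPhi {y : ℝ} (hy : -1 ≤ y) : herbrandPsi v w (herbrandPhi v w y) = y :=
  ((herbrandPhi_strictMono v w).injective.injOn).leftInvOn_invFunOn (Set.mem_Ici.mpr hy)

lemma upperGroup_herbrandPhi {y : ℝ} (hy : -1 ≤ y) :
    upperGroup v w (herbrandPhi v w y) = lowerGroupReal v w y := by
  rw [upperGroup, herbrandPsi_herbrandPhi v w hy]

/-- Every jump of the upper numbering is the image under the Herbrand function of a jump of the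
lower numbering, which is an integer. -/
lemma IsUpperJump.exists_lower_jump {u : ℝ} (hu : IsUpperJump v w u) :
    ∃ m : ℤ, -1 ≤ m ∧ herbrandPhi v w m = u ∧ lowerGroup v w (m + 1) < lowerGroup v w m := by
  obtain ⟨hu1, hu⟩ := hu
  obtain ⟨hy1, hyu⟩ := herbrandPsi_mem v w hu1
  set y := herbrandPsi v w u with hy
  have hjump : ∀ z : ℝ, y < z → lowerGroupReal v w z < lowerGroupReal v w y := by
    intro z hz
    have h := hu (herbrandPhi v w z - u) (sub_pos.mpr (hyu ▸ herbrandPhi_strictMono v w hz))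
    rw [add_sub_cancel, upperGroup_herbrandPhi v w (hy1.trans hz.le)] at h
    exact h
  have hint : (⌈y⌉ : ℝ) = y := by
    refine le_antisymm (not_lt.mp fun h ↦ ?_) (Int.le_ceil y)
    have := hjump _ h
    rw [lowerGroupReal_intCast] at this
    exact lt_irrefl _ this
  refine ⟨⌈y⌉, ?_, by rw [hint, hyu], ?_⟩
  · have : ((-1 : ℤ) : ℝ) ≤ ⌈y⌉ := by rw [hint]; push_cast; exact hy1
    exact_mod_cast this
  · have := hjump ((⌈y⌉ + 1 : ℤ) : ℝ) (by push_cast; rw [hint]; linarith)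
    rw [lowerGroupReal_intCast] at this
    exact this

end Herbrand

section Count

variable {K L : Type*} [Field K] [Field L] [Algebra K L] {v : Valuation K ℤᵐ⁰}
  {w : Valuation L ℤᵐ⁰} [v.HasExtension w] [FiniteDimensional K L] [IsGalois K L]
  [Algebra.IsSeparable (IsLocalRing.ResidueField v.valuationSubring)
      (IsLocalRing.ResidueField w.valuationSubring)]

/-- Counting pairs `(i, g)` with `1 ≤ i ≤ n` and `g ∈ G_i` in two ways. -/
lemma sum_card_lowerGroup (hinv : ∀ (σ : Gal(L/K)) (x : L), w (σ x) = w x) {π : L}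
    (hπ : w π = WithZero.exp (-1 : ℤ)) [Fintype (lowerGroup v w 0)] (n : ℕ) :
    ∑ i ∈ range n, (Nat.card (lowerGroup v w (i + 1)) : ℤ) =
      ∑ g : lowerGroup v w 0, truncBrk w π n g := by
  classical
  have T := totRam_inertia (v := v) hinv hπ
  have hcard : ∀ i ∈ range n, (Nat.card (lowerGroup v w (i + 1)) : ℤ) =
      ∑ g : lowerGroup v w 0, if (i : ℤ) + 1 ≤ truncBrk w π n g then 1 else 0 := by
    intro i hi
    have hle : lowerGroup v w (i + 1) ≤ lowerGroup v w 0 := lowerGroup_antitone v w (by omega)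
    rw [← Nat.card_congr (Subgroup.subgroupOfEquivOfLe hle).toEquiv, Nat.card_eq_fintype_card,
      sum_boole, ← Fintype.card_subtype]
    refine congrArg _ (Fintype.card_congr (Equiv.subtypeEquivRight fun g ↦ ?_))
    rw [mem_range] at hi
    rw [Subgroup.mem_subgroupOf, mem_lowerGroup_iff_dep hinv hπ, ← T.zpow_le_zpow_iff,
      T.zpow_truncBrk, max_le_iff, and_iff_left (T.zpow_le_zpow_iff.mpr (by omega))]
  rw [sum_congr rfl hcard, sum_comm]
  refine sum_congr rfl fun g _ ↦ ?_
  have h1 : truncBrk w π n g ≤ n := by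
    rw [← T.zpow_le_zpow_iff, T.zpow_truncBrk]
    exact le_max_right _ _
  have h2 : 0 ≤ truncBrk w π n g := by
    rw [← T.zpow_le_zpow_iff, T.zpow_truncBrk, zpow_zero]
    refine max_le (T.dep_le_one g) ?_
    rw [← zpow_zero (w π), T.zpow_le_zpow_iff]
    omega
  obtain ⟨q, hq⟩ := Int.eq_ofNat_of_zero_le h2
  rw [hq, sum_boole]
  have h3 : (range n).filter (fun i : ℕ ↦ (i : ℤ) + 1 ≤ q) = range q := by
    ext i
    simp only [mem_filter, mem_range]
    omega
  rw [h3, card_range]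

/-- The Herbrand function takes integral values at the lower jumps. -/
lemma exists_int_herbrandPhi (hinv : ∀ (σ : Gal(L/K)) (x : L), w (σ x) = w x)
    (hw : Function.Surjective w) (hab : ∀ σ τ : Gal(L/K), σ * τ = τ * σ) {m : ℤ} (hm : -1 ≤ m)
    (hjump : lowerGroup v w (m + 1) < lowerGroup v w m) :
    ∃ n : ℤ, (n : ℝ) = herbrandPhi v w m := by
  classical
  rcases (show m = -1 ∨ m = 0 ∨ 1 ≤ m by omega) with rfl | rfl | hm1
  · exact ⟨-1, by push_cast; rw [herbrandPhi_neg_one]⟩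
  · exact ⟨0, by push_cast; rw [herbrandPhi_zero]⟩
  obtain ⟨π, hπ⟩ := hw (WithZero.exp (-1 : ℤ))
  obtain ⟨n, rfl⟩ := Int.eq_ofNat_of_zero_le (show 0 ≤ m by omega)
  cases nonempty_fintype (lowerGroup v w 0)
  have T := totRam_inertia (v := v) hinv hπ
  obtain ⟨a, ha, ha'⟩ := SetLike.exists_of_lt hjump
  have ha0 : a ∈ lowerGroup v w 0 := lowerGroup_antitone v w (by omega) ha
  have hdep : dep w π (⟨a, ha0⟩ : lowerGroup v w 0) = w π ^ (n : ℤ) := by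
    refine le_antisymm ((mem_lowerGroup_iff_dep hinv hπ ⟨a, ha0⟩).mp ha) (not_lt.mp fun h ↦ ?_)
    exact ha' ((mem_lowerGroup_iff_dep hinv hπ ⟨a, ha0⟩).mpr (T.le_zpow_succ h))
  let : CommGroup (lowerGroup v w 0) :=
    { (inferInstance : Group (lowerGroup v w 0)) with
      mul_comm := fun x y ↦ Subtype.ext (hab x y) }
  obtain ⟨q, hq⟩ := T.card_dvd_sum_truncBrk hm1 hdep
  refine ⟨q, ?_⟩
  have h0 : (Nat.card (lowerGroup v w 0) : ℝ) ≠ 0 := by exact_mod_cast Nat.card_pos.ne'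
  have h1 := sum_card_lowerGroup (v := v) hinv hπ n
  rw [hq] at h1
  rw [Int.cast_natCast, herbrandPhi_natCast, eq_div_iff h0, mul_comm]
  exact_mod_cast h1.symm

end Count

end HasseArf

/-- Hasse–Arf: the jumps of the upper numbering ramification filtration of a finite abelian
extension of complete discretely valued fields with separable residue extension are integers. -/
theorem mainTheorem2 {K L : Type*} [Field K] [Field L] [Algebra K L]
    [Valued K (WithZero (Multiplicative ℤ))] [CompleteSpace K]
    (hv : HasseArf.IsDiscreteValuation (Valued.v : Valuation K (WithZero (Multiplicative ℤ))))
    (w : Valuation L (WithZero (Multiplicative ℤ)))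
    (hw : HasseArf.IsDiscreteValuation w)
    [(Valued.v : Valuation K (WithZero (Multiplicative ℤ))).HasExtension w]
    [FiniteDimensional K L] [IsGalois K L]
    (hab : ∀ σ τ : Gal(L/K), σ * τ = τ * σ)
    [Algebra.IsSeparable
      (IsLocalRing.ResidueField
        (Valued.v : Valuation K (WithZero (Multiplicative ℤ))).valuationSubring)
      (IsLocalRing.ResidueField w.valuationSubring)]
    (u : ℝ) (hu : HasseArf.IsUpperJump (Valued.v : Valuation K (WithZero (Multiplicative ℤ))) w u) :
    ∃ n : ℤ, (n : ℝ) = u := by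
  obtain ⟨m, hm, rfl, hjump⟩ := hu.exists_lower_jump
  exact HasseArf.exists_int_herbrandPhi (HasseArf.valuation_algEquiv hv w) hw hab hm hjump
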